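/- Let $d\ge 1$, let $\Omega\subset\mathbb R^d$ be a bounded domain with smooth boundary $\Gamma$, outward unit normal $n$ and signed distance $\rho$ (negative in $\Omega$), and let $\delta_0>0$ be such that every point of $U_{\delta_0}(\Gamma)=\{|\rho|<\delta_0\}$ has a unique closest point $p(x)\in\Gamma$. Let $\mathcal T^h$ be a finite conforming mesh of $d$-simplices covering $\Omega\cup U_{\delta_0}(\Gamma)$, with mesh size $h=\max_T\operatorname{diam}T$, which is shape regular (each $T$ contains a ball of radius $\operatorname{diam}(T)/\sigma$) and quasi-uniform ($h\le\kappa\operatorname{diam}T$ for all $T$). Let $\rho^h$ be continuous on the mesh and affine on each element, and put $\Gamma^h=\{\rho^h=0\}$, $\Omega^h=\{\rho^h<0\}$ (subsets of the region covered by the mesh). Assume, for a constant $C>0$, that $\Gamma^h\subset U_{\delta_0}(\Gamma)$, that $p:\Gamma^h\to\Gamma$ is a bijection, that $|\rho|\le C h^2$ on $\Gamma^h$, and that $|n\circ p-n^h|\le C h$ a.e. on $\Gamma^h$, where $n^h$ is the unit normal of $\Gamma^h$ exterior to $\Omega^h$. Let $\mathcal T_\Omega^h=\{T\in\mathcal T^h: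 T^\circ\cap\Omega^h\ne\emptyset\}$ and $\mathcal T_\Gamma^h=\{T\in\mathcal T_\Omega^h:T\cap\Gamma^h\neq\emptyset\}$. Let $\mathcal F_\Omega^h$ be the set of interior faces $F=T^+\cap T^-$ (common facets of two distinct elements $T^\pm\in\mathcal T_\Omega^h$), and $\mathcal F_\Omega^{h,g}$ the set of those with $T^+\in\mathcal T_\Gamma^h$ or $T^-\in\mathcal T_\Gamma^h$. Let $V_\Omega^h=\bigoplus_{T\in\mathcal T_\Omega^h}P_1(T)$. On a face let $n_F$ be the unit normal exterior to $T^+$, $[w]=w^+-w^-$ and $\{n_F\cdot\nabla w\}=\tfrac12 n_F\cdot(\nabla w^++\nabla w^-)$. For parameters $\gamma,\mu,\tau>0$ set $$a_\Omega^h(v,w)=(\nabla v,\nabla w)_{\mathcal T_\Omega^h\cap\Omega^h}+(v,w)_{\mathcal T_\Omega^h\cap\Omega^h}+\gamma(h^{-1}[v],[w])_{\mathcal F_\Omega^h}-(\{n_F\cdot\nabla v\},[w])_{\mathcal F_\Omega^h\cap\Omega^h}-([v],\{n_F\cdot\nabla w\})_{\mathcal F_\Omega^h\cap\Omega^h},$$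 $$j_\Omega^h(v,w)=\mu h^{-1}([v],[w])_{\mathcal F_\Omega^{h,g}}+\tau h(n_F\cdot[\nabla v],n_F\cdot[\nabla w])_{\mathcal F_\Omega^{h,g}},\qquad A_\Omega^h=a_\Omega^h+j_\Omega^h,$$ $$|||v|||_{h,\Omega}^2=\|\nabla v\|_{\Omega^h}^2+\|v\|_{\Omega^h}^2+\|h^{-1/2}[v]\|_{\mathcal F_\Omega^h}^2+j_\Omega^h(v,v).$$ Then $A_\Omega^h$ is coercive with respect to $|||\cdot|||_{h,\Omega}$, uniformly in the cut configuration: there are constants $\gamma_0>0$ and $c>0$, depending only on $d,\sigma,\kappa,\mu,\tau$, and for every $\Omega,\delta_0,C$ as above there is $h_0>0$, such that for all meshes $\mathcal T^h$ and functions $\rho^h$ as above with $h\le h_0$ and all $\gamma\ge\gamma_0$, $$c\,|||v|||_{h,\Omega}^2\le A_\Omega^h(v,v)\qquad\text{for all } v\in V_\Omega^h .$$ -/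

import Mathlib

open MeasureTheory Set Topology
open scoped Gradient ContDiff RealInnerProductSpace

noncomputable section

namespace CutDG

/-- Euclidean space `ℝ^d`. -/
abbrev Pt (d : ℕ) := EuclideanSpace ℝ (Fin d)

variable {d : ℕ}

/-! ### The smooth domain -/

/-- The field `∇f / |∇f|`. -/
def unitNormal (f : Pt d → ℝ) (x : Pt d) : Pt d := ‖∇ f x‖⁻¹ • ∇ f x

/-- Near `y` the set `Ω` is the negativity set of the smooth function `φ`, and `∇φ(y) ≠ 0`. -/
def IsLocalDefiningFunction (Ω : Set (Pt d)) (y : Pt d) (φ : Pt d → ℝ) : Prop :=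
  ContDiff ℝ ∞ φ ∧ ∇ φ y ≠ 0 ∧ ∀ᶠ x in 𝓝 y, (x ∈ Ω ↔ φ x < 0)

/-- A bounded domain (nonempty, open, connected) with smooth boundary. -/
structure IsSmoothDomain (Ω : Set (Pt d)) : Prop where
  isOpen : IsOpen Ω
  isConnected : IsConnected Ω
  isBounded : Bornology.IsBounded Ω
  smooth_boundary : ∀ y ∈ frontier Ω, ∃ φ, IsLocalDefiningFunction Ω y φ

open Classical in
/-- The outward unit normal `n_Γ` on `Γ = ∂Ω`; it does not depend on the local defining function
that is chosen. -/
def outwardNormal (Ω : Set (Pt d)) (y : Pt d) : Pt d :=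
  if h : ∃ φ, IsLocalDefiningFunction Ω y φ then unitNormal h.choose y else 0

open Classical in
/-- The signed distance `ρ` to `Γ = ∂Ω`, negative in `Ω`. -/
def signedDist (Ω : Set (Pt d)) (x : Pt d) : ℝ :=
  if x ∈ Ω then -Metric.infDist x (frontier Ω) else Metric.infDist x (frontier Ω)

/-- The tubular neighbourhood `U_δ(Γ) = {x : |ρ(x)| < δ}`. -/
def tube (Ω : Set (Pt d)) (δ : ℝ) : Set (Pt d) := {x | |signedDist Ω x| < δ}

/-- `y` is a closest point to `x` on `Γ = ∂Ω`. -/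
def IsClosestPoint (Ω : Set (Pt d)) (x y : Pt d) : Prop :=
  y ∈ frontier Ω ∧ dist x y = Metric.infDist x (frontier Ω)

/-- Every point of `U_δ(Γ)` has a unique closest point on `Γ`. -/
def IsTubularRadius (Ω : Set (Pt d)) (δ : ℝ) : Prop :=
  0 < δ ∧ ∀ x ∈ tube Ω δ, ∃! y, IsClosestPoint Ω x y

/-- The closest point projection `p`. -/
def closestPoint (Ω : Set (Pt d)) (x : Pt d) : Pt d := Classical.epsilon (IsClosestPoint Ω x)

/-! ### The background mesh -/

/-- The closed simplex with the given vertices. -/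
def simplex (T : Finset (Pt d)) : Set (Pt d) := convexHull ℝ (T : Set (Pt d))

/-- A finite conforming mesh of nondegenerate `d`-simplices in `ℝ^d`. An element is given by its
`d + 1` vertices, and two elements meet in the simplex spanned by their common vertices. -/
structure Mesh (d : ℕ) where
  elements : Finset (Finset (Pt d))
  card_eq : ∀ T ∈ elements, T.card = d + 1
  indep : ∀ T ∈ elements, AffineIndependent ℝ ((↑) : T → Pt d)
  conforming : ∀ T ∈ elements, ∀ T' ∈ elements,
    simplex T ∩ simplex T' = convexHull ℝ ((T : Set (Pt d)) ∩ (T' : Set (Pt d)))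

/-- The region covered by the mesh. -/
def Mesh.domain (M : Mesh d) : Set (Pt d) := ⋃ T ∈ M.elements, simplex T

/-- The global mesh size: the largest diameter of an element. -/
def Mesh.size (M : Mesh d) : ℝ := ⨆ T : M.elements, Metric.diam (simplex (T : Finset (Pt d)))

/-- Every element contains a ball of radius `diam T / σ`. -/
def Mesh.IsShapeRegular (M : Mesh d) (σ : ℝ) : Prop :=
  ∀ T ∈ M.elements, ∃ x, Metric.closedBall x (Metric.diam (simplex T) / σ) ⊆ simplex T

/-- All element diameters are comparable to the mesh size. -/
def Mesh.IsQuasiUniform (M : Mesh d) (κ : ℝ) : Prop :=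
  ∀ T ∈ M.elements, M.size ≤ κ * Metric.diam (simplex T)

/-- `ρh` is continuous on the mesh and affine on each element. -/
def IsPiecewiseLinear (M : Mesh d) (ρh : Pt d → ℝ) : Prop :=
  ContinuousOn ρh M.domain ∧
    ∀ T ∈ M.elements, ∃ a : Pt d →ᵃ[ℝ] ℝ, EqOn ρh a (simplex T)

/-- The discrete surface `Γ^h`. -/
def discreteSurface (M : Mesh d) (ρh : Pt d → ℝ) : Set (Pt d) := {x ∈ M.domain | ρh x = 0}

/-- The discrete bulk domain `Ω^h`. -/
def discreteBulk (M : Mesh d) (ρh : Pt d → ℝ) : Set (Pt d) := {x ∈ M.domain | ρh x < 0}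

open Classical in
/-- The active bulk mesh `𝒯_Ω^h`: the elements whose interior meets `Ω^h`. -/
def activeBulk (M : Mesh d) (ρh : Pt d → ℝ) : Finset (Finset (Pt d)) :=
  {T ∈ M.elements | (interior (simplex T) ∩ discreteBulk M ρh).Nonempty}

open Classical in
/-- The active surface mesh `𝒯_Γ^h`: the elements of `𝒯_Ω^h` that meet `Γ^h`. -/
def activeSurface (M : Mesh d) (ρh : Pt d → ℝ) : Finset (Finset (Pt d)) :=
  {T ∈ activeBulk M ρh | (simplex T ∩ discreteSurface M ρh).Nonempty}

/-- The assumptions on the background mesh and on the discrete level set function `ρh`, for a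
domain `Ω` with tubular radius `δ₀` and a constant `C`. -/
structure IsAdmissibleCut (Ω : Set (Pt d)) (δ₀ C : ℝ) (M : Mesh d) (ρh : Pt d → ℝ) : Prop where
  covers : Ω ∪ tube Ω δ₀ ⊆ M.domain
  piecewiseLinear : IsPiecewiseLinear M ρh
  surface_subset : discreteSurface M ρh ⊆ tube Ω δ₀
  bijOn : BijOn (closestPoint Ω) (discreteSurface M ρh) (frontier Ω)
  dist_le : ∀ x ∈ discreteSurface M ρh, |signedDist Ω x| ≤ C * M.size ^ 2
  /-- `|n ∘ p - n^h| ≤ C h` almost everywhere on `Γ^h`. On the flat piece `Γ^h ∩ T` with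
  `T ∈ 𝒯_Γ^h` the unit normal `n^h` exterior to `Ω^h` is the normalized gradient of `ρh|_T`. -/
  normal_le : ∀ T ∈ activeSurface M ρh, ∀ a : Pt d →ᵃ[ℝ] ℝ, EqOn ρh a (simplex T) →
    ∀ᵐ x ∂((μHE[d - 1] : Measure (Pt d)).restrict (simplex T ∩ discreteSurface M ρh)),
      ‖outwardNormal Ω (closestPoint Ω x) - unitNormal a x‖ ≤ C * M.size

/-! ### Broken space, faces, jumps and averages -/

/-- The broken space `⨁_{T ∈ 𝒯_Ω^h} P₁(T)`: one affine function for each active element.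
(An affine function on a nondegenerate simplex is the same as an affine function on `ℝ^d`.) -/
abbrev BulkSpace (M : Mesh d) (ρh : Pt d → ℝ) := activeBulk M ρh → (Pt d →ᵃ[ℝ] ℝ)

/-- A pair of active elements, listed as `(T⁺, T⁻)`. -/
abbrev ActivePair (M : Mesh d) (ρh : Pt d → ℝ) := activeBulk M ρh × activeBulk M ρh

/-- The face `F = T⁺ ∩ T⁻` as a subset of `ℝ^d`. -/
def face {M : Mesh d} {ρh : Pt d → ℝ} (p : ActivePair M ρh) : Set (Pt d) :=
  simplex (p.1 : Finset (Pt d)) ∩ simplex (p.2 : Finset (Pt d))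

open Classical in
/-- The interior faces `ℱ_Ω^h` of the active bulk mesh: pairs `(T⁺, T⁻)` of distinct active elements
whose intersection is a common facet. Each face occurs once: an auxiliary well-order decides which
of the two elements is called `T⁺` (the forms below do not depend on this labelling). -/
def bulkFaces (M : Mesh d) (ρh : Pt d → ℝ) : Finset (ActivePair M ρh) :=
  {p | WellOrderingRel p.1 p.2 ∧
    ((p.1 : Finset (Pt d)) ∩ (p.2 : Finset (Pt d))).card = d}

open Classical in
/-- The faces `ℱ_Ω^{h,g}` on which the ghost penalty acts. -/
def ghostFaces (M : Mesh d) (ρh : Pt d → ℝ) : Finset (ActivePair M ρh) :=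
  {p ∈ bulkFaces M ρh |
    (p.1 : Finset (Pt d)) ∈ activeSurface M ρh ∨ (p.2 : Finset (Pt d)) ∈ activeSurface M ρh}

/-- `ν` is the unit normal of the facet `T ∩ T'` of `T` that points out of `T`. -/
def IsFaceNormal (T T' : Finset (Pt d)) (ν : Pt d) : Prop :=
  ‖ν‖ = 1 ∧ (∀ x ∈ T ∩ T', ∀ y ∈ T ∩ T', ⟪ν, x - y⟫ = 0) ∧
    ∀ x ∈ T, ∀ y ∈ T ∩ T', ⟪ν, x - y⟫ ≤ 0

/-- The face normal `n_F = n_F⁺`. -/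
def faceNormal {M : Mesh d} {ρh : Pt d → ℝ} (p : ActivePair M ρh) : Pt d :=
  Classical.epsilon (IsFaceNormal (p.1 : Finset (Pt d)) (p.2 : Finset (Pt d)))

/-- The jump `[v] = v⁺ - v⁻`. -/
def jump {M : Mesh d} {ρh : Pt d → ℝ} (v : BulkSpace M ρh) (p : ActivePair M ρh) (x : Pt d) : ℝ :=
  v p.1 x - v p.2 x

/-- The normal jump `n_F · [∇v]`. -/
def gradJump {M : Mesh d} {ρh : Pt d → ℝ} (v : BulkSpace M ρh) (p : ActivePair M ρh)
    (x : Pt d) : ℝ :=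
  ⟪faceNormal p, ∇ (v p.1) x - ∇ (v p.2) x⟫

/-- The average flux `{n_F · ∇v} = ½ n_F⁺ · (∇v⁺ + ∇v⁻)`. -/
def meanFlux {M : Mesh d} {ρh : Pt d → ℝ} (v : BulkSpace M ρh) (p : ActivePair M ρh)
    (x : Pt d) : ℝ :=
  1 / 2 * ⟪faceNormal p, ∇ (v p.1) x + ∇ (v p.2) x⟫

/-! ### Bilinear forms and energy norm; `μHE[d - 1]` is the surface measure -/

/-- `(∇v, ∇w)` on `𝒯_Ω^h ∩ Ω^h`. -/
def gradForm (M : Mesh d) (ρh : Pt d → ℝ) (v w : BulkSpace M ρh) : ℝ :=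
  ∑ T : activeBulk M ρh, ∫ x in simplex (T : Finset (Pt d)) ∩ discreteBulk M ρh,
    ⟪∇ (v T) x, ∇ (w T) x⟫

/-- `(v, w)` on `𝒯_Ω^h ∩ Ω^h`. -/
def massForm (M : Mesh d) (ρh : Pt d → ℝ) (v w : BulkSpace M ρh) : ℝ :=
  ∑ T : activeBulk M ρh, ∫ x in simplex (T : Finset (Pt d)) ∩ discreteBulk M ρh, v T x * w T x

/-- `(h⁻¹ [v], [w])` on `ℱ_Ω^h` (entire faces). -/
def jumpForm (M : Mesh d) (ρh : Pt d → ℝ) (v w : BulkSpace M ρh) : ℝ :=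
  ∑ p ∈ bulkFaces M ρh, ∫ x in face p, M.size⁻¹ * jump v p x * jump w p x ∂μHE[d - 1]

/-- `({n_F · ∇v}, [w])` on `ℱ_Ω^h ∩ Ω^h` (the physical parts of the faces). -/
def fluxForm (M : Mesh d) (ρh : Pt d → ℝ) (v w : BulkSpace M ρh) : ℝ :=
  ∑ p ∈ bulkFaces M ρh, ∫ x in face p ∩ discreteBulk M ρh, meanFlux v p x * jump w p x ∂μHE[d - 1]

/-- The symmetric interior penalty form `a_Ω^h`. -/
def bulkForm (M : Mesh d) (ρh : Pt d → ℝ) (γ : ℝ) (v w : BulkSpace M ρh) : ℝ :=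
  gradForm M ρh v w + massForm M ρh v w + γ * jumpForm M ρh v w
    - fluxForm M ρh v w - fluxForm M ρh w v

/-- The ghost penalty `j_Ω^h`. -/
def ghostForm (M : Mesh d) (ρh : Pt d → ℝ) (μ τ : ℝ) (v w : BulkSpace M ρh) : ℝ :=
  μ * M.size⁻¹ * (∑ p ∈ ghostFaces M ρh, ∫ x in face p, jump v p x * jump w p x ∂μHE[d - 1])
    + τ * M.size *
      (∑ p ∈ ghostFaces M ρh, ∫ x in face p, gradJump v p x * gradJump w p x ∂μHE[d - 1])

/-- The stabilized bulk form `A_Ω^h = a_Ω^h + j_Ω^h`. -/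
def stabilizedForm (M : Mesh d) (ρh : Pt d → ℝ) (γ μ τ : ℝ) (v w : BulkSpace M ρh) : ℝ :=
  bulkForm M ρh γ v w + ghostForm M ρh μ τ v w

/-- The squared discrete energy norm
`|||v|||²_{h,Ω} = ‖∇v‖²_{Ω^h} + ‖v‖²_{Ω^h} + ‖h^{-1/2} [v]‖²_{ℱ_Ω^h} + j_Ω^h(v, v)`. -/
def energyNormSq (M : Mesh d) (ρh : Pt d → ℝ) (μ τ : ℝ) (v : BulkSpace M ρh) : ℝ :=
  gradForm M ρh v v + massForm M ρh v v + jumpForm M ρh v v + ghostForm M ρh μ τ v v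

end CutDG

end

/-!
Write `g_T` for the constant gradient of `v` on an element `T`. In `A(v, v)` only the flux term has
no sign. By Young's inequality on each face it is bounded by a small multiple of `h^d ∑_T |g_T|²`
plus a multiple of the jump term, which a large `γ` absorbs (`two_mul_abs_fluxForm_le`). So
everything rests on bounding `h^d ∑_T |g_T|²`, the energy on the *full* active elements, by the
energy on `Ω^h` and the face terms (`sum_gradient_le`), with a constant independent of how `Γ^h`
cuts the elements.

Elements that do not meet `Γ^h` lie in `Ω^h` and cause no problem. Across a ghost face the jump of
`g` has a normal part, which is penalized, and a tangential part, which is controlled by the jump of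
`v` through an inverse inequality on the face (`jumpConst_mul_le`). This uses that a facet contains
a disc of radius comparable to `h` (`exists_disc_subset_facet`). Hence it is enough to join each cut
element to an element inside `Ω^h` by a chain of active elements with common facets, all within
distance `O(h)`; their number is then bounded because the elements contain disjoint balls of
comparable radius (`Mesh.card_near_le`).

The chain is found geometrically (`exists_cluster`). At the scale of `h` the smooth compact boundary
`Γ` is flat (`IsSmoothDomain.exists_flat_radius`). From a point of `Ω^h` in the cut element one
follows a segment of length `10h` against the normal `n` of `Γ` at a nearby point. The function `ρh`
stays negative on it: at a first zero, in an element `S`, the gradient of `ρh|_S` would have a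
negative component along `n`; but `Γ^h ∩ S` has positive surface measure, so the assumption on
`n^h`, which holds almost everywhere, makes this gradient nearly parallel to `n`. At its end the
segment is too far from `Γ` for `Γ^h` to be met. Starting from a generic point, the segment avoids
the codimension-two skeleton, so by conformity two elements that meet on it share a facet, and
connectedness of the segment gives connectedness of the chain.
-/

noncomputable section

namespace CutDG

variable {d : ℕ}

/-! ### Affine functions and their gradients -/

/-- The constant gradient of an affine function on `ℝ^d`. -/
def slope (a : Pt d →ᵃ[ℝ] ℝ) : Pt d :=
  (InnerProductSpace.toDual ℝ (Pt d)).symm (LinearMap.toContinuousLinearMap a.linear)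

lemma inner_slope (a : Pt d →ᵃ[ℝ] ℝ) (w : Pt d) : ⟪slope a, w⟫ = a.linear w := by
  simp [slope]

lemma affine_eq_add_inner_slope (a : Pt d →ᵃ[ℝ] ℝ) (x y : Pt d) :
    a x = a y + ⟪slope a, x - y⟫ := by
  rw [inner_slope]
  have := a.linearMap_vsub x y
  simp only [vsub_eq_sub] at this
  rw [this]; ring

lemma slope_sub (a b : Pt d →ᵃ[ℝ] ℝ) : slope (a - b) = slope a - slope b := by
  refine ext_inner_right ℝ fun w => ?_
  simp [inner_slope, inner_sub_left]

lemma gradient_affine (a : Pt d →ᵃ[ℝ] ℝ) (x : Pt d) : ∇ a x = slope a := by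
  apply HasGradientAt.gradient
  rw [hasGradientAt_iff_hasFDerivAt]
  simp only [slope, LinearIsometryEquiv.apply_symm_apply]
  have h : (a : Pt d → ℝ) = fun z => LinearMap.toContinuousLinearMap a.linear z + a 0 := by
    funext z
    have := a.linearMap_vsub z 0
    simp only [vsub_eq_sub, sub_zero] at this
    simp [this]
  rw [h]
  exact (ContinuousLinearMap.hasFDerivAt _).add_const _

lemma continuous_affine (a : Pt d →ᵃ[ℝ] ℝ) : Continuous a :=
  AffineMap.continuous_of_finiteDimensional a

/-! ### Discs in hyperplanes -/

/-- The closed disc of radius `r` around `c` in the hyperplane through `c` orthogonal to `ν`. -/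
def hyperDisc (ν c : Pt d) (r : ℝ) : Set (Pt d) := {x | ⟪ν, x - c⟫ = 0 ∧ ‖x - c‖ ≤ r}

/-- The volume of the unit ball in `ℝ^(d-1)`. -/
def discVolume (d : ℕ) : ℝ :=
  (volume : Measure (EuclideanSpace ℝ (Fin (d - 1)))).real (Metric.closedBall 0 1)

lemma discVolume_pos : 0 < discVolume d := by
  refine ENNReal.toReal_pos (Metric.measure_closedBall_pos _ _ one_pos).ne' ?_
  exact (isCompact_closedBall _ _).measure_lt_top.ne

lemma measure_hyperDisc {ν : Pt d} (hν : ν ≠ 0) (c : Pt d) {r : ℝ} (hr : 0 ≤ r) :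
    μHE[d - 1] (hyperDisc ν c r) = ENNReal.ofReal (discVolume d * r ^ (d - 1)) := by
  have hd : d ≠ 0 := by
    rintro rfl
    exact hν (Subsingleton.elim _ _)
  have hfin : Module.finrank ℝ (ℝ ∙ ν)ᗮ = d - 1 := by
    have : Fact (Module.finrank ℝ (Pt d) = (d - 1) + 1) := ⟨by simp; omega⟩
    exact Submodule.finrank_orthogonal_span_singleton hν
  let φ := ((stdOrthonormalBasis ℝ (ℝ ∙ ν)ᗮ).reindex (finCongr hfin)).repr.symm
  let f : EuclideanSpace ℝ (Fin (d - 1)) → Pt d := fun x => (φ x : Pt d) + c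
  have hf : Isometry f := by
    refine Isometry.of_dist_eq fun x y => ?_
    simp only [f, dist_add_right]
    rw [← φ.dist_map x y]; rfl
  have himg : hyperDisc ν c r = f '' Metric.closedBall 0 r := by
    ext x
    constructor
    · rintro ⟨h1, h2⟩
      have hx : x - c ∈ (ℝ ∙ ν)ᗮ := by
        rwa [Submodule.mem_orthogonal_singleton_iff_inner_right]
      refine ⟨φ.symm ⟨x - c, hx⟩, ?_, by simp [f]⟩
      rw [mem_closedBall_zero_iff, LinearIsometryEquiv.norm_map]
      exact h2
    · rintro ⟨z, hz, rfl⟩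
      refine ⟨?_, ?_⟩
      · have := (φ z).2
        rw [Submodule.mem_orthogonal_singleton_iff_inner_right] at this
        simpa [f] using this
      · rw [mem_closedBall_zero_iff] at hz
        have : ‖((φ z : (ℝ ∙ ν)ᗮ) : Pt d)‖ = ‖z‖ := φ.norm_map z
        simpa [f, this] using hz
  rw [himg, hf.euclideanHausdorffMeasure_image, EuclideanSpace.euclideanHausdorffMeasure_eq_volume,
    Measure.addHaar_closedBall' _ _ hr, discVolume, mul_comm, ENNReal.ofReal_mul (by positivity)]
  congr 1
  · rw [Measure.real, ENNReal.ofReal_toReal]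
    exact (isCompact_closedBall _ _).measure_lt_top.ne
  · simp

lemma isClosed_hyperDisc (ν c : Pt d) (r : ℝ) : IsClosed (hyperDisc ν c r) := by
  have h : Continuous fun x : Pt d => x - c := by fun_prop
  exact (isClosed_eq (continuous_const.inner h) continuous_const).inter
    (isClosed_le h.norm continuous_const)

lemma hyperDisc_subset_hyperDisc {ν c c' : Pt d} {r r' : ℝ} (h : ⟪ν, c' - c⟫ = 0)
    (hr : ‖c' - c‖ + r' ≤ r) : hyperDisc ν c' r' ⊆ hyperDisc ν c r := by
  rintro x ⟨h1, h2⟩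
  have hx : x - c = (x - c') + (c' - c) := by abel
  refine ⟨by rw [hx, inner_add_right, h1, h, add_zero], ?_⟩
  rw [hx]
  exact (norm_add_le _ _).trans (by linarith)

/-- The part of `g` orthogonal to the unit vector `ν`. -/
def tangential (ν g : Pt d) : Pt d := g - ⟪ν, g⟫ • ν

lemma inner_tangential {ν : Pt d} (hν : ‖ν‖ = 1) (g : Pt d) : ⟪ν, tangential ν g⟫ = 0 := by
  simp [tangential, inner_sub_right, inner_smul_right, hν]

lemma norm_sq_eq_normal_add_tangential {ν : Pt d} (hν : ‖ν‖ = 1) (g : Pt d) :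
    ‖g‖ ^ 2 = ⟪ν, g⟫ ^ 2 + ‖tangential ν g‖ ^ 2 := by
  have h : g = ⟪ν, g⟫ • ν + tangential ν g := by simp [tangential]
  have h0 : ⟪⟪ν, g⟫ • ν, tangential ν g⟫ = 0 := by
    rw [inner_smul_left, inner_tangential hν, mul_zero]
  conv_lhs => rw [h]
  rw [norm_add_sq_real, h0, norm_smul, hν]
  simp

/-- Inverse inequality on a face: an affine function has on one half of a disc an absolute value
of at least a quarter of the radius times the tangential gradient. -/
lemma le_integral_sq_of_hyperDisc_subset {ν c : Pt d} {r : ℝ} {F : Set (Pt d)} (hν : ‖ν‖ = 1)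
    (hr : 0 ≤ r) (hF : IsCompact F) (hFμ : μHE[d - 1] F ≠ ⊤) (hsub : hyperDisc ν c r ⊆ F)
    (q : Pt d →ᵃ[ℝ] ℝ) :
    discVolume d * (r / 4) ^ (d - 1) * (‖tangential ν (slope q)‖ * (r / 4)) ^ 2 ≤
      ∫ x in F, q x ^ 2 ∂μHE[d - 1] := by
  set g := tangential ν (slope q) with hg
  have hν0 : ν ≠ 0 := by rintro rfl; simp at hν
  rcases eq_or_ne g 0 with h0 | h0
  · simp only [h0, norm_zero, zero_mul, ne_eq, OfNat.ofNat_ne_zero, not_false_eq_true, zero_pow,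
      mul_zero]
    exact integral_nonneg fun x => sq_nonneg _
  have hgpos : 0 < ‖g‖ := norm_pos_iff.2 h0
  obtain ⟨s, hs, hsq⟩ : ∃ s : ℝ, s ^ 2 = 1 ∧ 0 ≤ s * q c := by
    rcases le_total 0 (q c) with h | h
    · exact ⟨1, by norm_num, by simpa using h⟩
    · exact ⟨-1, by norm_num, by simpa using h⟩
  have habs : |s| = 1 := by rw [← sq_eq_sq₀ (abs_nonneg _) zero_le_one, sq_abs, hs, one_pow]
  set c' := c + (s * (r / 2) * ‖g‖⁻¹) • g with hc'
  have hc'c : c' - c = (s * (r / 2) * ‖g‖⁻¹) • g := by simp [hc']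
  have hsub' : hyperDisc ν c' (r / 4) ⊆ hyperDisc ν c r := by
    apply hyperDisc_subset_hyperDisc
    · rw [hc'c, inner_smul_right, inner_tangential hν, mul_zero]
    · rw [hc'c, norm_smul, norm_mul, norm_mul, Real.norm_eq_abs, habs, norm_inv, norm_norm,
        Real.norm_eq_abs, abs_of_nonneg (by positivity : 0 ≤ r / 2)]
      rw [mul_assoc, inv_mul_cancel₀ hgpos.ne']
      linarith
  have hlow : ∀ x ∈ hyperDisc ν c' (r / 4), (‖g‖ * (r / 4)) ^ 2 ≤ q x ^ 2 := by
    intro x hx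
    have hperp := (hsub' hx).1
    have h1 : ⟪slope q, x - c⟫ = ⟪g, x - c⟫ := by
      rw [hg, tangential, inner_sub_left, inner_smul_left, hperp]; simp
    have h2 : ⟪g, x - c⟫ = ⟪g, x - c'⟫ + s * (r / 2) * ‖g‖ := by
      have : x - c = (x - c') + (c' - c) := by abel
      rw [this, inner_add_right, hc'c, inner_smul_right, real_inner_self_eq_norm_sq]
      field_simp
    have h3 : |⟪g, x - c'⟫| ≤ ‖g‖ * (r / 4) :=
      (abs_real_inner_le_norm _ _).trans (mul_le_mul_of_nonneg_left hx.2 (norm_nonneg _))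
    have h4 : |s * ⟪g, x - c'⟫| ≤ ‖g‖ * (r / 4) := by rwa [abs_mul, habs, one_mul]
    have h5 : s * q x = s * q c + s * ⟪g, x - c'⟫ + s ^ 2 * (r / 2) * ‖g‖ := by
      rw [affine_eq_add_inner_slope q x c, h1, h2]; ring
    have h6 : ‖g‖ * (r / 4) ≤ s * q x := by
      rw [h5, hs]
      have := (abs_le.1 h4).1
      linarith
    calc (‖g‖ * (r / 4)) ^ 2 ≤ (s * q x) ^ 2 := by gcongr
      _ = q x ^ 2 := by rw [mul_pow, hs, one_mul]
  have hint : IntegrableOn (fun x => q x ^ 2) F μHE[d - 1] :=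
    ((continuous_affine q).pow 2).continuousOn.integrableOn_of_subset_isCompact hF hF.measurableSet
      subset_rfl hFμ
  calc discVolume d * (r / 4) ^ (d - 1) * (‖g‖ * (r / 4)) ^ 2
      = (‖g‖ * (r / 4)) ^ 2 * (μHE[d - 1]).real (hyperDisc ν c' (r / 4)) := by
        rw [Measure.real, measure_hyperDisc hν0 _ (by positivity), ENNReal.toReal_ofReal, mul_comm]
        exact mul_nonneg discVolume_pos.le (by positivity)
    _ ≤ ∫ x in hyperDisc ν c' (r / 4), q x ^ 2 ∂μHE[d - 1] := by
        apply setIntegral_ge_of_const_le_real (isClosed_hyperDisc _ _ _).measurableSet _ hlow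
        · exact hint.mono_set (hsub'.trans hsub)
        · exact measure_ne_top_of_subset (hsub'.trans hsub) hFμ
    _ ≤ ∫ x in F, q x ^ 2 ∂μHE[d - 1] :=
        setIntegral_mono_set hint (ae_of_all _ fun x => sq_nonneg _)
          (hsub'.trans hsub).eventuallyLE

/-! ### Simplices and their facets -/

/-- The vertices of a nondegenerate simplex as an affine basis; its coordinates are the barycentric
coordinates of the simplex. -/
def vertexBasis {T : Finset (Pt d)} (hc : T.card = d + 1)
    (hi : AffineIndependent ℝ ((↑) : T → Pt d)) : AffineBasis T ℝ (Pt d) :=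
  ⟨(↑), hi, by
    rw [hi.affineSpan_eq_top_iff_card_eq_finrank_add_one]
    simp [hc]⟩

section Simplex

variable {T : Finset (Pt d)} (hc : T.card = d + 1) (hi : AffineIndependent ℝ ((↑) : T → Pt d))

@[simp] lemma vertexBasis_apply (i : T) : vertexBasis hc hi i = (i : Pt d) := rfl

lemma range_vertexBasis : range (vertexBasis hc hi) = (T : Set (Pt d)) := by
  ext x; simp

lemma coord_vertex_self (i : T) : (vertexBasis hc hi).coord i (i : Pt d) = 1 := by
  rw [← vertexBasis_apply hc hi i]
  exact (vertexBasis hc hi).coord_apply_eq i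

lemma coord_vertex_of_ne {i : T} {y : Pt d} (hy : y ∈ T) (h : (i : Pt d) ≠ y) :
    (vertexBasis hc hi).coord i y = 0 := by
  have h' : i ≠ ⟨y, hy⟩ := fun e => h (congrArg Subtype.val e)
  have := (vertexBasis hc hi).coord_apply_ne h'
  rwa [vertexBasis_apply] at this

lemma mem_simplex_iff {x : Pt d} :
    x ∈ simplex T ↔ ∀ i, 0 ≤ (vertexBasis hc hi).coord i x := by
  rw [simplex, ← range_vertexBasis hc hi, AffineBasis.convexHull_eq_nonneg_coord]; rfl

lemma mem_interior_simplex_iff {x : Pt d} :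
    x ∈ interior (simplex T) ↔ ∀ i, 0 < (vertexBasis hc hi).coord i x := by
  rw [simplex, ← range_vertexBasis hc hi, AffineBasis.interior_convexHull]; rfl

lemma mem_convexHull_of_coord {S : Set (Pt d)} {x : Pt d} (hx : x ∈ simplex T)
    (h0 : ∀ i : T, (i : Pt d) ∉ S → (vertexBasis hc hi).coord i x = 0) :
    x ∈ convexHull ℝ ((T : Set (Pt d)) ∩ S) := by
  classical
  have hx' := (mem_simplex_iff hc hi).1 hx
  have hsum := (vertexBasis hc hi).sum_coord_apply_eq_one x
  have hlin := (vertexBasis hc hi).linear_combination_coord_eq_self x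
  have hzero : ∀ i ∈ Finset.univ, i ∉ Finset.univ.filter (fun i : T => (i : Pt d) ∈ S) →
      (vertexBasis hc hi).coord i x = 0 := by
    intro i _ hiS
    exact h0 i (by simpa using hiS)
  rw [← Finset.sum_subset (Finset.subset_univ _) hzero] at hsum
  rw [← Finset.sum_subset (Finset.subset_univ _)
    (fun i hi' hiS => by rw [hzero i hi' hiS, zero_smul])] at hlin
  rw [← hlin]
  refine (convex_convexHull ℝ _).sum_mem (fun i _ => hx' i) hsum fun i hiS => ?_
  exact subset_convexHull ℝ _ ⟨i.2, (Finset.mem_filter.1 hiS).2⟩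

lemma coord_eq_zero_of_mem_convexHull {S : Set (Pt d)} {x : Pt d}
    (hx : x ∈ convexHull ℝ ((T : Set (Pt d)) ∩ S)) {i : T} (hiS : (i : Pt d) ∉ S) :
    (vertexBasis hc hi).coord i x = 0 := by
  have hconv : Convex ℝ {y | (vertexBasis hc hi).coord i y = 0} :=
    (convex_singleton (0 : ℝ)).affine_preimage ((vertexBasis hc hi).coord i)
  refine convexHull_min ?_ hconv hx
  rintro y ⟨hyT, hyS⟩
  exact coord_vertex_of_ne hc hi hyT fun h => hiS (h ▸ hyS)

end Simplex

lemma isCompact_simplex (T : Finset (Pt d)) : IsCompact (simplex T) :=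
  T.finite_toSet.isCompact_convexHull _

lemma convex_simplex (T : Finset (Pt d)) : Convex ℝ (simplex T) := convex_convexHull ℝ _

lemma dist_le_of_mem_simplex {T : Finset (Pt d)} {x y : Pt d} {R : ℝ}
    (hR : Metric.diam (simplex T) ≤ R) (hx : x ∈ simplex T) (hy : y ∈ simplex T) :
    dist x y ≤ R :=
  (Metric.dist_le_diam_of_mem (isCompact_simplex T).isBounded hx hy).trans hR

section Facet

variable {A B : Finset (Pt d)}

/-- If two elements share `d` of their `d + 1` vertices, exactly one vertex of the first one is
missing in the second one: the apex over the common facet. -/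
lemma exists_apex (hA : A.card = d + 1) [DecidableEq (Pt d)] (hAB : (A ∩ B).card = d) :
    ∃ z : A, ∀ w : A, (w : Pt d) ∉ B ↔ w = z := by
  have h1 : (A \ B).card = 1 := by
    have := Finset.card_sdiff_add_card_inter A B
    omega
  obtain ⟨z, hz⟩ := Finset.card_eq_one.1 h1
  have hmem : ∀ w, w ∈ A \ B ↔ w = z := fun w => by rw [hz, Finset.mem_singleton]
  have hzA : z ∈ A := (Finset.mem_sdiff.1 ((hmem z).2 rfl)).1
  refine ⟨⟨z, hzA⟩, fun w => ?_⟩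
  rw [Subtype.ext_iff, ← hmem w, Finset.mem_sdiff]
  simp [w.2]

/-- A facet of a simplex contains a disc whose radius is that of a ball in the simplex: the image
of the parallel slice through the centre of the ball under the homothety centred at the apex. -/
lemma exists_disc_subset_facet (hA : A.card = d + 1)
    (hi : AffineIndependent ℝ ((↑) : A → Pt d)) (hd : 1 ≤ d) {z : A}
    (hz : ∀ w : A, (w : Pt d) ∉ B ↔ w = z) {x₀ : Pt d} {r : ℝ} (hr : 0 < r)
    (hball : Metric.closedBall x₀ r ⊆ simplex A) :
    ∃ c, hyperDisc (slope ((vertexBasis hA hi).coord z)) c r ⊆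
      convexHull ℝ ((A : Set (Pt d)) ∩ (B : Set (Pt d))) := by
  set b := vertexBasis hA hi with hb
  have hx₀ : x₀ ∈ interior (simplex A) :=
    interior_mono hball (by
      rw [mem_interior_iff_mem_nhds]; exact Metric.closedBall_mem_nhds _ hr)
  rw [mem_interior_simplex_iff hA hi] at hx₀
  have hs0 := hx₀ z
  have hs1 : b.coord z x₀ < 1 := by
    obtain ⟨w, hw⟩ : ∃ w : A, w ≠ z := by
      have : Nontrivial A := by
        rw [← Fintype.one_lt_card_iff_nontrivial]; simp [hA]; omega
      exact exists_ne z
    have hsum := b.sum_coord_apply_eq_one x₀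
    have h2 := Finset.add_le_sum (f := fun i => b.coord i x₀) (s := Finset.univ)
      (fun i _ => (hx₀ i).le) (Finset.mem_univ w) (Finset.mem_univ z) hw
    have := hx₀ w
    rw [hsum] at h2
    linarith
  set s := b.coord z x₀ with hs
  have hcoord : ∀ (i : A) (x y : Pt d), b.coord i x = b.coord i y + (b.coord i).linear (x - y) := by
    intro i x y
    rw [affine_eq_add_inner_slope (b.coord i) x y, inner_slope]
  have hz1 : b.coord z (z : Pt d) = 1 := coord_vertex_self hA hi z
  have hlin : (b.coord z).linear (x₀ - z) = s - 1 := by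
    have := hcoord z x₀ z
    rw [hz1] at this; linarith
  have hs1' : (1 - s) ≠ 0 := by linarith
  refine ⟨(z : Pt d) + (1 - s)⁻¹ • (x₀ - z), ?_⟩
  rintro w ⟨hw1, hw2⟩
  set c := (z : Pt d) + (1 - s)⁻¹ • (x₀ - z) with hcdef
  have hc0 : b.coord z c = 0 := by
    rw [hcoord z _ z, hz1, hcdef, add_sub_cancel_left, map_smul, hlin, smul_eq_mul]
    field_simp; ring
  have hw0 : b.coord z w = 0 := by
    rw [affine_eq_add_inner_slope _ w c, hc0, hw1, add_zero]
  -- The homothety with centre `z` and factor `1 - s` maps the disc back into the ball.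
  have hxmem : (z : Pt d) + (1 - s) • (w - z) ∈ simplex A := by
    apply hball
    rw [mem_closedBall_iff_norm]
    have : (z : Pt d) + (1 - s) • (w - z) - x₀ = (1 - s) • (w - c) := by
      rw [hcdef, ← sub_sub, smul_sub _ (w - z), smul_smul, mul_inv_cancel₀ hs1', one_smul]
      abel
    rw [this, norm_smul, Real.norm_eq_abs, abs_of_pos (by linarith)]
    nlinarith [norm_nonneg (w - c)]
  have hwA : w ∈ simplex A := by
    rw [mem_simplex_iff hA hi] at hxmem ⊢
    intro i
    rcases eq_or_ne i z with rfl | hne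
    · exact hw0.ge
    · have h1 := hxmem i
      have hiz : b.coord i (z : Pt d) = 0 := coord_vertex_of_ne hA hi z.2 (Subtype.coe_ne_coe.2 hne)
      have h2 : b.coord i w = (b.coord i).linear (w - z) := by
        rw [hcoord i w z, hiz, zero_add]
      rw [← hb, hcoord i _ z, hiz, add_sub_cancel_left, map_smul, zero_add, smul_eq_mul,
        ← h2] at h1
      exact nonneg_of_mul_nonneg_right h1 (by linarith)
  exact mem_convexHull_of_coord hA hi hwA fun i hiB => by
    rw [(hz i).1 hiB]; exact hw0

lemma slope_coord_ne_zero (hA : A.card = d + 1)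
    (hi : AffineIndependent ℝ ((↑) : A → Pt d)) {z w : A} (h : w ≠ z) :
    slope ((vertexBasis hA hi).coord z) ≠ 0 := by
  intro h0
  have h1 := affine_eq_add_inner_slope ((vertexBasis hA hi).coord z) (z : Pt d) (w : Pt d)
  have h2 : (vertexBasis hA hi).coord z (z : Pt d) = 1 := coord_vertex_self hA hi z
  have h3 : (vertexBasis hA hi).coord z (w : Pt d) = 0 :=
    coord_vertex_of_ne hA hi w.2 (Subtype.coe_ne_coe.2 h.symm)
  rw [h0, inner_zero_left, h2, h3] at h1
  norm_num at h1

lemma exists_isFaceNormal [DecidableEq (Pt d)] (hA : A.card = d + 1)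
    (hi : AffineIndependent ℝ ((↑) : A → Pt d)) (hd : 1 ≤ d) {z : A}
    (hz : ∀ w : A, (w : Pt d) ∉ B ↔ w = z) : ∃ ν, IsFaceNormal A B ν := by
  classical
  set b := vertexBasis hA hi
  obtain ⟨w, hw⟩ : ∃ w : A, w ≠ z := by
    have : Nontrivial A := by
      rw [← Fintype.one_lt_card_iff_nontrivial]; simp [hA]; omega
    exact exists_ne z
  have hne : slope (b.coord z) ≠ 0 := slope_coord_ne_zero hA hi hw
  have hco : ∀ x y : Pt d, ⟪slope (b.coord z), x - y⟫ = b.coord z x - b.coord z y := by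
    intro x y
    rw [affine_eq_add_inner_slope (b.coord z) x y]; ring
  have hface : ∀ x ∈ A ∩ B, b.coord z x = 0 := by
    intro x hx
    have hx' := Finset.mem_inter.1 hx
    exact coord_vertex_of_ne hA hi hx'.1 fun h => (hz z).2 rfl (h ▸ hx'.2)
  refine ⟨-(‖slope (b.coord z)‖⁻¹ • slope (b.coord z)), ?_, ?_, ?_⟩
  · rw [norm_neg, norm_smul, norm_inv, norm_norm, inv_mul_cancel₀ (norm_ne_zero_iff.2 hne)]
  · intro x hx y hy
    rw [inner_neg_left, inner_smul_left, hco, hface x (by convert hx), hface y (by convert hy)]; simp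
  · intro x hx y hy
    rw [inner_neg_left, inner_smul_left, hco, hface y (by convert hy), sub_zero]
    have : 0 ≤ b.coord z x :=
      (mem_simplex_iff hA hi).1 (subset_convexHull ℝ _ hx) z
    have h2 : 0 ≤ ‖slope (b.coord z)‖⁻¹ := by positivity
    simpa using mul_nonneg h2 this

/-- A face normal is a multiple of the gradient of the barycentric coordinate of the apex, because
`⟪ν, · - y⟫` vanishes at all other vertices. -/
lemma IsFaceNormal.eq_smul_slope {ν : Pt d} (hν : IsFaceNormal A B ν) (hA : A.card = d + 1)
    (hi : AffineIndependent ℝ ((↑) : A → Pt d)) (hd : 1 ≤ d) {z : A}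
    (hz : ∀ w : A, (w : Pt d) ∉ B ↔ w = z) :
    ∃ t : ℝ, ν = t • slope ((vertexBasis hA hi).coord z) := by
  classical
  set b := vertexBasis hA hi
  obtain ⟨y, hy⟩ : ∃ w : A, w ≠ z := by
    have : Nontrivial A := by
      rw [← Fintype.one_lt_card_iff_nontrivial]; simp [hA]; omega
    exact exists_ne z
  have hyB : (y : Pt d) ∈ B := by
    by_contra h
    exact hy ((hz y).1 h)
  refine ⟨⟪ν, (z : Pt d) - y⟫, ?_⟩
  refine ext_inner_right ℝ fun x => ?_
  have key : ∀ x : Pt d, ⟪ν, x - y⟫ = b.coord z x * ⟪ν, (z : Pt d) - y⟫ := by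
    intro x
    have h1 := b.linear_combination_coord_eq_self x
    have h2 := b.sum_coord_apply_eq_one x
    have h3 : x - y = ∑ i, b.coord i x • ((i : Pt d) - y) := by
      simp_rw [smul_sub]
      rw [Finset.sum_sub_distrib, ← Finset.sum_smul, h2, one_smul]
      conv_lhs => rw [← h1]
      rfl
    conv_lhs => rw [h3]
    rw [inner_sum, Finset.sum_eq_single z]
    · rw [inner_smul_right]
    · intro i _ hiz
      have hiB : (i : Pt d) ∈ B := by
        by_contra h
        exact hiz ((hz i).1 h)
      rw [inner_smul_right, hν.2.1 i (by simp [hiB]) y (by simp [hyB]), mul_zero]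
    · simp
  have h4 := key (x + y)
  rw [add_sub_cancel_right] at h4
  have h5 : b.coord z (x + y) = ⟪slope (b.coord z), x⟫ := by
    rw [affine_eq_add_inner_slope (b.coord z) (x + y) y, add_sub_cancel_right]
    have : b.coord z (y : Pt d) = 0 := coord_vertex_of_ne hA hi y.2 (Subtype.coe_ne_coe.2 hy.symm)
    rw [this, zero_add]
  rw [h4, h5, inner_smul_left, mul_comm]
  simp

lemma hyperDisc_smul {t : ℝ} (ht : t ≠ 0) (ν c : Pt d) (r : ℝ) :
    hyperDisc (t • ν) c r = hyperDisc ν c r := by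
  ext x
  simp [hyperDisc, inner_smul_left, ht]

/-- The facet common to two elements lies between two discs orthogonal to the face normal. -/
lemma facet_between_discs [DecidableEq (Pt d)] (hA : A.card = d + 1)
    (hi : AffineIndependent ℝ ((↑) : A → Pt d)) (hd : 1 ≤ d) (hAB : (A ∩ B).card = d)
    {x₀ : Pt d} {r R : ℝ} (hr : 0 < r) (hball : Metric.closedBall x₀ r ⊆ simplex A)
    (hR : Metric.diam (simplex A) ≤ R) :
    ‖Classical.epsilon (IsFaceNormal A B)‖ = 1 ∧
    (∃ c, hyperDisc (Classical.epsilon (IsFaceNormal A B)) c r ⊆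
      convexHull ℝ ((A : Set (Pt d)) ∩ (B : Set (Pt d)))) ∧
    ∃ c, convexHull ℝ ((A : Set (Pt d)) ∩ (B : Set (Pt d))) ⊆
      hyperDisc (Classical.epsilon (IsFaceNormal A B)) c R := by
  obtain ⟨z, hz⟩ := exists_apex hA hAB
  have hν := Classical.epsilon_spec (exists_isFaceNormal hA hi hd hz)
  set ν := Classical.epsilon (IsFaceNormal A B)
  obtain ⟨t, ht⟩ := hν.eq_smul_slope hA hi hd hz
  have ht0 : t ≠ 0 := by
    rintro rfl
    have := hν.1
    rw [ht] at this; simp at this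
  refine ⟨hν.1, ?_, ?_⟩
  · obtain ⟨c, hc⟩ := exists_disc_subset_facet hA hi hd hz hr hball
    exact ⟨c, by rw [ht, hyperDisc_smul ht0]; exact hc⟩
  · obtain ⟨y, hy⟩ : (A ∩ B).Nonempty := by
      rw [← Finset.card_pos, hAB]; omega
    have hsub : convexHull ℝ ((A : Set (Pt d)) ∩ (B : Set (Pt d))) ⊆ simplex A :=
      convexHull_mono inter_subset_left
    have hyF : y ∈ convexHull ℝ ((A : Set (Pt d)) ∩ (B : Set (Pt d))) :=
      subset_convexHull ℝ _ (by simpa using hy)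
    refine ⟨y, fun x hx => ?_⟩
    rw [ht, hyperDisc_smul ht0]
    have hzB := (hz z).2 rfl
    refine ⟨?_, ?_⟩
    · have h1 := coord_eq_zero_of_mem_convexHull hA hi hx hzB
      have h2 := coord_eq_zero_of_mem_convexHull hA hi hyF hzB
      rw [affine_eq_add_inner_slope _ x y, h2, zero_add] at h1
      exact h1
    · rw [← dist_eq_norm]
      exact dist_le_of_mem_simplex hR (hsub hx) (hsub hyF)

end Facet

/-! ### Shape regular quasi-uniform meshes -/

lemma interior_simplex_nonempty {T : Finset (Pt d)} (hc : T.card = d + 1)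
    (hi : AffineIndependent ℝ ((↑) : T → Pt d)) : (interior (simplex T)).Nonempty := by
  rw [simplex, ← range_vertexBasis hc hi]
  exact ⟨_, (vertexBasis hc hi).centroid_mem_interior_convexHull⟩

lemma simplex_subset_closure_interior {T : Finset (Pt d)} (hc : T.card = d + 1)
    (hi : AffineIndependent ℝ ((↑) : T → Pt d)) : simplex T ⊆ closure (interior (simplex T)) := by
  rw [(convex_simplex T).closure_interior_eq_closure_of_nonempty_interior
    (interior_simplex_nonempty hc hi)]
  exact subset_closure

/-- Two sets have points at distance at most `R`. -/
def Near (R : ℝ) (S T : Set (Pt d)) : Prop := ∃ x ∈ S, ∃ y ∈ T, dist x y ≤ R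

lemma Near.symm {R : ℝ} {S T : Set (Pt d)} (h : Near R S T) : Near R T S := by
  obtain ⟨x, hx, y, hy, hxy⟩ := h
  exact ⟨y, hy, x, hx, by rwa [dist_comm]⟩

namespace Mesh

variable {M : Mesh d}

lemma diam_le_size {T : Finset (Pt d)} (hT : T ∈ M.elements) :
    Metric.diam (simplex T) ≤ M.size :=
  le_ciSup (f := fun T : M.elements => Metric.diam (simplex (T : Finset (Pt d))))
    (Set.finite_range _).bddAbove ⟨T, hT⟩

lemma size_pos (hd : 1 ≤ d) {T : Finset (Pt d)} (hT : T ∈ M.elements) : 0 < M.size := by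
  obtain ⟨x, hx, y, hy, hxy⟩ := Finset.one_lt_card.1 (by rw [M.card_eq T hT]; omega : 1 < T.card)
  exact (dist_pos.2 hxy).trans_le (dist_le_of_mem_simplex (diam_le_size hT)
    (subset_convexHull ℝ _ hx) (subset_convexHull ℝ _ hy))

lemma exists_closedBall_subset {σ κ : ℝ} (hσ : 0 < σ) (hκ : 0 < κ) (hr : M.IsShapeRegular σ)
    (hq : M.IsQuasiUniform κ) {T : Finset (Pt d)} (hT : T ∈ M.elements) :
    ∃ x, Metric.closedBall x ((κ * σ)⁻¹ * M.size) ⊆ simplex T := by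
  obtain ⟨x, hx⟩ := hr T hT
  refine ⟨x, (Metric.closedBall_subset_closedBall ?_).trans hx⟩
  rw [mul_inv, div_eq_inv_mul]
  calc κ⁻¹ * σ⁻¹ * M.size ≤ κ⁻¹ * σ⁻¹ * (κ * Metric.diam (simplex T)) := by
        gcongr; exact hq T hT
    _ = σ⁻¹ * Metric.diam (simplex T) := by field_simp

lemma disjoint_interior {A B : Finset (Pt d)} (hA : A ∈ M.elements) (hB : B ∈ M.elements)
    (hAB : A ≠ B) : Disjoint (interior (simplex A)) (interior (simplex B)) := by
  rw [Set.disjoint_left]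
  intro x hxA hxB
  obtain ⟨z, hzA, hzB⟩ : ∃ z ∈ A, z ∉ B := by
    by_contra! h
    exact hAB (Finset.eq_of_subset_of_card_le h (by rw [M.card_eq A hA, M.card_eq B hB]))
  have hx : x ∈ convexHull ℝ ((A : Set (Pt d)) ∩ (B : Set (Pt d))) := by
    rw [← M.conforming A hA B hB]
    exact ⟨interior_subset hxA, interior_subset hxB⟩
  have h0 := coord_eq_zero_of_mem_convexHull (M.card_eq A hA) (M.indep A hA) hx (i := ⟨z, hzA⟩) hzB
  have h1 := (mem_interior_simplex_iff (M.card_eq A hA) (M.indep A hA)).1 hxA ⟨z, hzA⟩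
  exact h1.ne' h0

/-- The elements near a given one are bounded in number, because they contain disjoint balls of
comparable radius. -/
lemma card_near_le {θ R : ℝ} (hθ : 0 < θ) (hM : 0 < M.size) (hR : 0 ≤ R)
    (hball : ∀ T ∈ M.elements, ∃ x, Metric.closedBall x (θ * M.size) ⊆ simplex T)
    {T : Finset (Pt d)} (hT : T ∈ M.elements) (E : Finset (Finset (Pt d))) (hE : E ⊆ M.elements)
    (hnear : ∀ S ∈ E, Near (R * M.size) (simplex T) (simplex S)) :
    (E.card : ℝ) ≤ ((R + 2) / θ) ^ d := by
  classical
  choose! c hc using hball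
  set h := M.size
  set β := (volume : Measure (Pt d)).real (Metric.ball 0 1) with hβ
  have hβ0 : 0 < β := ENNReal.toReal_pos (Metric.measure_ball_pos _ _ one_pos).ne'
    measure_ball_lt_top.ne
  have hvol : ∀ (x : Pt d) (r : ℝ), 0 < r → (volume : Measure (Pt d)).real (Metric.ball x r) =
      r ^ d * β := by
    intro x r hr
    rw [Measure.real, Measure.addHaar_ball_of_pos _ _ hr, ENNReal.toReal_mul,
      ENNReal.toReal_ofReal (by positivity), hβ, Measure.real]
    simp
  obtain ⟨x₀, hx₀⟩ : ∃ x₀, x₀ ∈ simplex T :=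
    ⟨c T, hc T hT (Metric.mem_closedBall_self (by positivity))⟩
  have hsub : ∀ S ∈ E, Metric.ball (c S) (θ * h) ⊆ simplex S := fun S hS =>
    Metric.ball_subset_closedBall.trans (hc S (hE hS))
  have hdisj : (E : Set (Finset (Pt d))).PairwiseDisjoint
      fun S => Metric.ball (c S) (θ * h) := by
    intro A hA B hB hAB
    exact (disjoint_interior (hE hA) (hE hB) hAB).mono
      (interior_maximal (hsub A hA) Metric.isOpen_ball)
      (interior_maximal (hsub B hB) Metric.isOpen_ball)
  have hunion : ⋃ S ∈ E, Metric.ball (c S) (θ * h) ⊆ Metric.closedBall x₀ ((R + 2) * h) := by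
    refine iUnion₂_subset fun S hS => fun z hz => ?_
    obtain ⟨x, hx, y, hy, hxy⟩ := hnear S hS
    have h1 := dist_le_of_mem_simplex (diam_le_size (hE hS)) (hsub S hS hz) hy
    have h2 := dist_le_of_mem_simplex (diam_le_size hT) hx hx₀
    rw [Metric.mem_closedBall]
    have h3 := dist_triangle z y x₀
    have h4 := dist_triangle y x x₀
    rw [dist_comm y x] at h4
    change _ ≤ h at h1 h2
    linarith
  have key := measureReal_mono (μ := (volume : Measure (Pt d))) hunion
    measure_closedBall_lt_top.ne
  rw [measureReal_biUnion_finset hdisj (fun _ _ => measurableSet_ball)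
    (fun _ _ => measure_ball_lt_top.ne), Measure.real, Measure.addHaar_closedBall _ _ (by positivity),
    ENNReal.toReal_mul, ENNReal.toReal_ofReal (by positivity)] at key
  simp only [hvol _ _ (mul_pos hθ hM), Finset.sum_const, nsmul_eq_mul, finrank_euclideanSpace,
    Fintype.card_fin] at key
  change _ ≤ _ * β at key
  rw [← mul_assoc] at key
  have key2 := le_of_mul_le_mul_right key hβ0
  rw [mul_pow, mul_pow, ← mul_assoc] at key2
  have key3 := le_of_mul_le_mul_right key2 (pow_pos hM d)
  rw [div_pow, le_div_iff₀ (pow_pos hθ d)]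
  exact key3

end Mesh

/-! ### Lines in general position -/

/-- Almost every line with direction `e` misses the hull of a set of fewer than `d` points, since
the lines that meet it fill a proper affine subspace. -/
lemma volume_line_meets_convexHull (e : Pt d) {S : Finset (Pt d)} (hS : S.card < d) :
    volume {x : Pt d | ∃ t : ℝ, x + t • e ∈ convexHull ℝ (S : Set (Pt d))} = 0 := by
  classical
  rcases S.eq_empty_or_nonempty with rfl | ⟨s₀, hs₀⟩
  · simp
  set G : Finset (Pt d) := insert e ((S.erase s₀).image fun s => s - s₀)
  set W := Submodule.span ℝ (G : Set (Pt d))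
  have hW : Module.finrank ℝ W < d := by
    refine (finrank_span_finset_le_card G).trans_lt ((Finset.card_insert_le _ _).trans_lt ?_)
    have h1 := Finset.card_image_le (s := S.erase s₀) (f := fun s => s - s₀)
    have h2 := Finset.card_erase_add_one hs₀
    omega
  have heW : e ∈ W := Submodule.subset_span (by simp [G])
  have hhull : convexHull ℝ (S : Set (Pt d)) ⊆ (AffineSubspace.mk' s₀ W : Set (Pt d)) := by
    refine convexHull_min (fun s hs => ?_) (AffineSubspace.convex _)
    rw [SetLike.mem_coe, AffineSubspace.mem_mk', vsub_eq_sub]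
    rcases eq_or_ne s s₀ with rfl | hne
    · simp
    · refine Submodule.subset_span ?_
      have : s - s₀ ∈ (S.erase s₀).image fun s => s - s₀ :=
        Finset.mem_image_of_mem _ (Finset.mem_erase.2 ⟨hne, hs⟩)
      simp only [G, Finset.coe_insert]
      exact Or.inr this
  refine measure_mono_null (t := (AffineSubspace.mk' s₀ W : Set (Pt d))) ?_
    (Measure.addHaar_affineSubspace _ _ ?_)
  · rintro x ⟨t, ht⟩
    have h1 := hhull ht
    rw [SetLike.mem_coe, AffineSubspace.mem_mk', vsub_eq_sub] at h1 ⊢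
    have h2 := W.sub_mem h1 (W.smul_mem t heW)
    have h3 : x + t • e - s₀ - t • e = x - s₀ := by abel
    rwa [h3] at h2
  · intro htop
    have h1 := congrArg AffineSubspace.direction htop
    rw [AffineSubspace.direction_mk', AffineSubspace.direction_top] at h1
    rw [h1] at hW
    simp at hW

/-- A point is in general position if it lies in no hull of fewer than `d` vertices of one element,
i.e. off the codimension-two skeleton. -/
def Mesh.IsGeneric (M : Mesh d) (x : Pt d) : Prop :=
  ∀ T ∈ M.elements, ∀ S ⊆ T, S.card < d → x ∉ convexHull ℝ (S : Set (Pt d))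

lemma Mesh.exists_generic_line (M : Mesh d) (e : Pt d) {U : Set (Pt d)} (hU : IsOpen U)
    (hne : U.Nonempty) : ∃ x ∈ U, ∀ t : ℝ, M.IsGeneric (x + t • e) := by
  classical
  let 𝒮 : Finset (Finset (Pt d)) := {S ∈ M.elements.biUnion Finset.powerset | S.card < d}
  have hnull : volume (⋃ S ∈ 𝒮,
      {x : Pt d | ∃ t : ℝ, x + t • e ∈ convexHull ℝ (S : Set (Pt d))}) = 0 := by
    refine (measure_biUnion_null_iff 𝒮.countable_toSet).2 fun S hS => ?_
    exact volume_line_meets_convexHull e (Finset.mem_filter.1 hS).2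
  obtain ⟨x, hxU, hx⟩ : ∃ x ∈ U, x ∉ ⋃ S ∈ 𝒮,
      {x : Pt d | ∃ t : ℝ, x + t • e ∈ convexHull ℝ (S : Set (Pt d))} := by
    by_contra! h
    exact (hU.measure_pos volume hne).ne' (measure_mono_null h hnull)
  refine ⟨x, hxU, fun t T hT S hST hS hmem => hx ?_⟩
  refine mem_iUnion₂.2 ⟨S, ?_, t, hmem⟩
  exact Finset.mem_filter.2 ⟨Finset.mem_biUnion.2 ⟨T, hT, Finset.mem_powerset.2 hST⟩, hS⟩

/-- At a generic point where an affine function with negative values on the element vanishes, its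
zero set in the element has positive surface measure: either it passes through the interior, or it
contains a facet. -/
lemma Mesh.measure_zeroSet_ne_zero (M : Mesh d) (hd : 1 ≤ d) {T : Finset (Pt d)}
    (hT : T ∈ M.elements) (a : Pt d →ᵃ[ℝ] ℝ) {y y' : Pt d} (hy : y ∈ simplex T)
    (hgen : M.IsGeneric y) (hay : a y = 0) (hy' : y' ∈ simplex T) (hay' : a y' < 0) :
    μHE[d - 1] (simplex T ∩ {x | a x = 0}) ≠ 0 := by
  classical
  have hc := M.card_eq T hT
  have hi := M.indep T hT
  have hpos : ∀ {ν c : Pt d} {r : ℝ}, ν ≠ 0 → 0 < r →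
      hyperDisc ν c r ⊆ simplex T ∩ {x | a x = 0} →
      μHE[d - 1] (simplex T ∩ {x | a x = 0}) ≠ 0 := by
    intro ν c r hν hr hsub h0
    have h1 := measure_mono_null hsub h0
    rw [measure_hyperDisc hν c hr.le, ENNReal.ofReal_eq_zero] at h1
    exact absurd h1 (not_le.2 (mul_pos discVolume_pos (pow_pos hr _)))
  have hint : ∀ U : Set (Pt d), IsOpen U → ∀ p ∈ simplex T, p ∈ U →
      ∃ p' ∈ interior (simplex T), p' ∈ U := by
    intro U hU p hp hpU
    obtain ⟨p', h1, h2⟩ := mem_closure_iff.1 (simplex_subset_closure_interior hc hi hp) U hU hpU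
    exact ⟨p', h2, h1⟩
  have hcont := continuous_affine a
  by_cases hv : ∃ v ∈ T, 0 < a v
  -- With values of both signs, `a` vanishes at an interior point.
  · obtain ⟨v, hvT, hv⟩ := hv
    obtain ⟨p, hp, hap⟩ := hint {x | 0 < a x} (isOpen_lt continuous_const hcont) v
      (subset_convexHull ℝ _ hvT) hv
    obtain ⟨q, hq, haq⟩ := hint {x | a x < 0} (isOpen_lt hcont continuous_const) y' hy' hay'
    obtain ⟨z, hz, haz⟩ := (convex_simplex T).interior.isPreconnected.intermediate_value hq hp
      hcont.continuousOn ⟨(show a q < 0 from haq).le, (show 0 < a p from hap).le⟩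
    obtain ⟨r, hr, hball⟩ := Metric.nhds_basis_closedBall.mem_iff.1
      (mem_interior_iff_mem_nhds.1 hz)
    refine hpos (ν := slope a) (c := z) ?_ hr ?_
    · intro h0
      have := affine_eq_add_inner_slope a y' y
      rw [h0, inner_zero_left, hay] at this
      linarith
    · rintro x ⟨h1, h2⟩
      refine ⟨hball (by rwa [mem_closedBall_iff_norm]), ?_⟩
      rw [mem_ofPred_eq, affine_eq_add_inner_slope a x z, haz, h1, add_zero]
  -- Otherwise the zero set is spanned by the vertices where `a` vanishes; at a generic point there
  -- are at least `d` of them.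
  · push Not at hv
    set b := vertexBasis hc hi with hb
    let S : Finset (Pt d) := {v ∈ T | a v = 0}
    have hST : S ⊆ T := Finset.filter_subset _ _
    have hcomb : ∀ x, a x = ∑ i : T, b.coord i x * a i := by
      intro x
      have h1 := b.linear_combination_coord_eq_self x
      have h2 := b.sum_coord_apply_eq_one x
      have h3 : ∀ i : T, a i = a 0 + ⟪slope a, (i : Pt d)⟫ := fun i => by
        rw [affine_eq_add_inner_slope a i 0, sub_zero]
      rw [affine_eq_add_inner_slope a x 0, sub_zero]
      conv_lhs => rw [← h1, inner_sum]
      simp_rw [h3, mul_add, Finset.sum_add_distrib, ← Finset.sum_mul, h2, one_mul,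
        inner_smul_right]
      rfl
    have hyS : y ∈ convexHull ℝ ((T : Set (Pt d)) ∩ (S : Set (Pt d))) := by
      refine mem_convexHull_of_coord hc hi hy fun i hiS => ?_
      have hnonneg := (mem_simplex_iff hc hi).1 hy
      have hsum := hcomb y
      rw [hay] at hsum
      have h0 := (Finset.sum_eq_zero_iff_of_nonpos (s := Finset.univ)
        (f := fun i : T => b.coord i y * a i)
        fun i _ => mul_nonpos_of_nonneg_of_nonpos (hnonneg i) (hv i i.2)).1 hsum.symm i
          (Finset.mem_univ i)
      refine (mul_eq_zero.1 h0).resolve_right fun hai => hiS ?_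
      exact Finset.mem_filter.2 ⟨i.2, hai⟩
    rw [← Finset.coe_inter, Finset.inter_eq_right.2 hST] at hyS
    have hcard : d ≤ S.card := by
      by_contra! h
      exact hgen T hT S hST h hyS
    have hSne : S ≠ T := by
      intro h
      have h0 : a y' = 0 := by
        rw [hcomb y']
        refine Finset.sum_eq_zero fun i _ => ?_
        have : (i : Pt d) ∈ S := by rw [h]; exact i.2
        rw [(Finset.mem_filter.1 this).2, mul_zero]
      exact hay'.ne h0
    have hTS : (T ∩ S).card = d := by
      rw [Finset.inter_eq_right.2 hST]
      have := Finset.card_lt_card (Finset.ssubset_iff_subset_ne.2 ⟨hST, hSne⟩)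
      omega
    obtain ⟨z, hz⟩ := exists_apex hc hTS
    obtain ⟨x₀, hx₀⟩ := interior_simplex_nonempty hc hi
    obtain ⟨r, hr, hball⟩ := Metric.nhds_basis_closedBall.mem_iff.1
      (mem_interior_iff_mem_nhds.1 hx₀)
    obtain ⟨c, hdisc⟩ := exists_disc_subset_facet hc hi hd hz hr hball
    obtain ⟨w, hw⟩ : ∃ w : T, w ≠ z := by
      have : Nontrivial T := by
        rw [← Fintype.one_lt_card_iff_nontrivial]; simp [hc]; omega
      exact exists_ne z
    refine hpos (c := c) (slope_coord_ne_zero hc hi hw) hr fun x hx => ?_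
    have hxS := hdisc hx
    refine ⟨convexHull_mono inter_subset_left hxS, ?_⟩
    have hconv : Convex ℝ {x | a x = 0} := (convex_singleton (0 : ℝ)).affine_preimage a
    exact convexHull_min (fun v hv => (Finset.mem_filter.1 hv.2).2) hconv hxS

/-! ### The smooth boundary is uniformly flat at small scales -/

namespace IsLocalDefiningFunction

variable {Ω : Set (Pt d)} {y : Pt d} {φ ψ : Pt d → ℝ}

lemma apply_eq_zero (h : IsLocalDefiningFunction Ω y φ) (hΩ : IsOpen Ω) (hy : y ∈ frontier Ω) :
    φ y = 0 := by
  have hyΩ : y ∉ Ω := by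
    rw [hΩ.frontier_eq] at hy
    exact hy.2
  refine le_antisymm ?_ (not_lt.1 fun hlt => hyΩ (h.2.2.self_of_nhds.2 hlt))
  have hfreq : ∃ᶠ x in 𝓝 y, x ∈ Ω := mem_closure_iff_frequently.1 (frontier_subset_closure hy)
  have hfreq' : ∃ᶠ x in 𝓝 y, φ x ≤ 0 :=
    (hfreq.and_eventually h.2.2).mono fun x hx => (hx.2.1 hx.1).le
  exact (isClosed_le h.1.continuous continuous_const).mem_of_frequently_of_tendsto hfreq'
    Filter.tendsto_id

lemma continuous_gradient (h : IsLocalDefiningFunction Ω y φ) : Continuous (∇ φ) := by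
  have : Continuous (fderiv ℝ φ) := h.1.continuous_fderiv (by simp)
  exact (InnerProductSpace.toDual ℝ (Pt d)).symm.continuous.comp this

lemma eventually (h : IsLocalDefiningFunction Ω y φ) :
    ∀ᶠ z in 𝓝 y, IsLocalDefiningFunction Ω z φ := by
  filter_upwards [h.continuous_gradient.continuousAt.eventually_ne h.2.1,
    eventually_eventually_nhds.2 h.2.2] with z h1 h2
  exact ⟨h.1, h1, h2⟩

lemma norm_unitNormal (h : IsLocalDefiningFunction Ω y φ) : ‖unitNormal φ y‖ = 1 := by
  rw [unitNormal, norm_smul, norm_inv, norm_norm, inv_mul_cancel₀ (norm_ne_zero_iff.2 h.2.1)]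

lemma inner_unitNormal (h : IsLocalDefiningFunction Ω y φ) (v : Pt d) :
    ⟪∇ φ y, v⟫ = ‖∇ φ y‖ * ⟪unitNormal φ y, v⟫ := by
  rw [unitNormal, inner_smul_left]
  have := norm_ne_zero_iff.2 h.2.1
  simp; field_simp

lemma hasDerivAt_line (h : IsLocalDefiningFunction Ω y φ) (v : Pt d) :
    HasDerivAt (fun t : ℝ => φ (y + t • v)) ⟪∇ φ y, v⟫ 0 := by
  have hd : DifferentiableAt ℝ φ y := h.1.differentiable (by simp) y
  have h1 : HasFDerivAt φ (InnerProductSpace.toDual ℝ (Pt d) (∇ φ y)) (y + (0 : ℝ) • v) := by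
    rw [zero_smul, add_zero]
    exact hd.hasGradientAt.hasFDerivAt
  have h2 : HasDerivAt (fun t : ℝ => y + t • v) v 0 := by
    simpa using ((hasDerivAt_id (0 : ℝ)).smul_const v).const_add y
  exact h1.comp_hasDerivAt (0 : ℝ) h2

lemma eventually_line (h : IsLocalDefiningFunction Ω y φ) (v : Pt d) :
    ∀ᶠ t : ℝ in 𝓝[>] 0, (y + t • v ∈ Ω ↔ φ (y + t • v) < 0) := by
  have hc : Filter.Tendsto (fun t : ℝ => y + t • v) (𝓝[>] 0) (𝓝 y) := by
    have : Continuous fun t : ℝ => y + t • v := by fun_prop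
    simpa using (this.tendsto 0).mono_left nhdsWithin_le_nhds
  exact hc.eventually h.2.2

lemma eventually_slope (h : IsLocalDefiningFunction Ω y φ) (hΩ : IsOpen Ω) (hy : y ∈ frontier Ω)
    (v : Pt d) : Filter.Tendsto (fun t : ℝ => t⁻¹ * φ (y + t • v)) (𝓝[>] 0) (𝓝 ⟪∇ φ y, v⟫) := by
  have hsub : Ioi (0 : ℝ) ⊆ {0}ᶜ := fun t ht => ne_of_gt ht
  have h1 := (hasDerivAt_iff_tendsto_slope_zero.1 (h.hasDerivAt_line v)).mono_left
    (nhdsWithin_mono _ hsub)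
  simpa [h.apply_eq_zero hΩ hy] using h1

/-- The unit normal does not depend on the defining function: a direction entering `Ω` for one of
them cannot leave `Ω` for the other. -/
lemma unitNormal_eq (hφ : IsLocalDefiningFunction Ω y φ) (hψ : IsLocalDefiningFunction Ω y ψ)
    (hΩ : IsOpen Ω) (hy : y ∈ frontier Ω) : unitNormal φ y = unitNormal ψ y := by
  have key : ∀ v, ⟪∇ φ y, v⟫ < 0 → ¬ 0 < ⟪∇ ψ y, v⟫ := by
    intro v h1 h2
    have e1 := (hφ.eventually_slope hΩ hy v).eventually (gt_mem_nhds h1)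
    have e2 := (hψ.eventually_slope hΩ hy v).eventually (lt_mem_nhds h2)
    obtain ⟨t, ht1, ht2, ht3, ht4, ht0⟩ := (e1.and (e2.and ((hφ.eventually_line v).and
      ((hψ.eventually_line v).and self_mem_nhdsWithin)))).exists
    have ht : 0 < t⁻¹ := inv_pos.2 ht0
    have hneg : φ (y + t • v) < 0 := by
      by_contra! hc
      exact absurd ht1 (not_lt.2 (mul_nonneg ht.le hc))
    have hneg' := ht4.1 (ht3.2 hneg)
    exact absurd ht2 (not_lt.2 (mul_nonpos_of_nonneg_of_nonpos ht.le hneg'.le))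
  by_contra hne
  have hp := hφ.norm_unitNormal
  have hq := hψ.norm_unitNormal
  have hlt : ⟪unitNormal φ y, unitNormal ψ y⟫ < 1 :=
    (inner_lt_one_iff_real_of_norm_eq_one hp hq).2 hne
  refine key (unitNormal ψ y - unitNormal φ y) ?_ ?_
  · rw [hφ.inner_unitNormal, inner_sub_right, real_inner_self_eq_norm_sq, hp]
    exact mul_neg_of_pos_of_neg (norm_pos_iff.2 hφ.2.1) (by linarith)
  · rw [hψ.inner_unitNormal, inner_sub_right, real_inner_self_eq_norm_sq, hq, real_inner_comm]
    exact mul_pos (norm_pos_iff.2 hψ.2.1) (by linarith)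

lemma outwardNormal_eq (h : IsLocalDefiningFunction Ω y φ) (hΩ : IsOpen Ω)
    (hy : y ∈ frontier Ω) : outwardNormal Ω y = unitNormal φ y := by
  have hex : ∃ φ, IsLocalDefiningFunction Ω y φ := ⟨φ, h⟩
  rw [outwardNormal, dif_pos hex]
  exact hex.choose_spec.unitNormal_eq h hΩ hy

end IsLocalDefiningFunction

lemma IsSmoothDomain.exists_nhds_flat {Ω : Set (Pt d)} (hΩ : IsSmoothDomain Ω) {y₀ : Pt d}
    (hy₀ : y₀ ∈ frontier Ω) : ∃ U : Set (Pt d), IsOpen U ∧ y₀ ∈ U ∧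
      ∀ y ∈ U, y ∈ frontier Ω → ∀ z ∈ U, z ∈ frontier Ω → ‖outwardNormal Ω y‖ = 1 ∧
        ‖outwardNormal Ω y - outwardNormal Ω z‖ ≤ 1 / 4 ∧
        |⟪outwardNormal Ω y, z - y⟫| ≤ 1 / 4 * ‖z - y‖ := by
  obtain ⟨φ, hφ⟩ := hΩ.smooth_boundary y₀ hy₀
  have hg : 0 < ‖∇ φ y₀‖ := norm_pos_iff.2 hφ.2.1
  have hstrict : HasStrictFDerivAt φ (fderiv ℝ φ y₀) y₀ :=
    hφ.1.contDiffAt.hasStrictFDerivAt (by simp)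
  have hlo := hstrict.isLittleO.def (c := ‖∇ φ y₀‖ / 8) (by positivity)
  rw [nhds_prod_eq] at hlo
  obtain ⟨V, hV, hVlo⟩ := Filter.mem_prod_self_iff.1 hlo
  have hcont : ContinuousAt (unitNormal φ) y₀ := by
    have hc := hφ.continuous_gradient.continuousAt (x := y₀)
    exact (hc.norm.inv₀ hg.ne').smul hc
  have hn : ∀ᶠ y in 𝓝 y₀, ‖unitNormal φ y - unitNormal φ y₀‖ < 1 / 8 := by
    have := Metric.tendsto_nhds.1 hcont (1 / 8) (by norm_num)
    simpa only [dist_eq_norm] using this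
  obtain ⟨U, hU, hUo, hyU⟩ := eventually_nhds_iff.1 ((hn.and hφ.eventually).and hV)
  refine ⟨U, hUo, hyU, fun y hy hyΓ z hz hzΓ => ?_⟩
  obtain ⟨⟨hny, hφy⟩, hyV⟩ := hU y hy
  obtain ⟨⟨hnz, hφz⟩, hzV⟩ := hU z hz
  rw [hφy.outwardNormal_eq hΩ.isOpen hyΓ, hφz.outwardNormal_eq hΩ.isOpen hzΓ]
  refine ⟨hφy.norm_unitNormal, ?_, ?_⟩
  · have h1 : unitNormal φ y - unitNormal φ z =
        (unitNormal φ y - unitNormal φ y₀) - (unitNormal φ z - unitNormal φ y₀) := by abel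
    rw [h1]
    exact (norm_sub_le _ _).trans (by linarith)
  · have h1 := hVlo (mk_mem_prod hzV hyV)
    simp only [mem_ofPred_eq, hφy.apply_eq_zero hΩ.isOpen hyΓ, hφz.apply_eq_zero hΩ.isOpen hzΓ,
      sub_zero, zero_sub, norm_neg] at h1
    have h2 : fderiv ℝ φ y₀ (z - y) = ‖∇ φ y₀‖ * ⟪unitNormal φ y₀, z - y⟫ := by
      rw [← hφ.inner_unitNormal, gradient, InnerProductSpace.toDual_symm_apply]
    rw [h2, norm_mul, norm_norm, Real.norm_eq_abs] at h1
    have h3 : |⟪unitNormal φ y₀, z - y⟫| ≤ 1 / 8 * ‖z - y‖ := by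
      refine le_of_mul_le_mul_left (h1.trans_eq ?_) hg
      ring
    have h4 : ⟪unitNormal φ y, z - y⟫ =
        ⟪unitNormal φ y₀, z - y⟫ + ⟪unitNormal φ y - unitNormal φ y₀, z - y⟫ := by
      rw [inner_sub_left]; ring
    have h5 : |⟪unitNormal φ y - unitNormal φ y₀, z - y⟫| ≤ 1 / 8 * ‖z - y‖ :=
      (abs_real_inner_le_norm _ _).trans (by gcongr)
    rw [h4]
    exact (abs_add_le _ _).trans (by linarith)

/-- The boundary is compact, so a Lebesgue number of the flat neighbourhoods works everywhere. -/
lemma IsSmoothDomain.exists_flat_radius {Ω : Set (Pt d)} (hΩ : IsSmoothDomain Ω) :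
    ∃ r : ℝ, 0 < r ∧ ∀ y ∈ frontier Ω, ∀ z ∈ frontier Ω, dist z y < r →
      ‖outwardNormal Ω y‖ = 1 ∧ ‖outwardNormal Ω y - outwardNormal Ω z‖ ≤ 1 / 4 ∧
        |⟪outwardNormal Ω y, z - y⟫| ≤ 1 / 4 * ‖z - y‖ := by
  have hcomp : IsCompact (frontier Ω) :=
    Metric.isCompact_of_isClosed_isBounded isClosed_frontier
      (hΩ.isBounded.closure.subset frontier_subset_closure)
  choose U hUo hyU hU using fun y : frontier Ω => hΩ.exists_nhds_flat y.2
  obtain ⟨r, hr, hball⟩ := lebesgue_number_lemma_of_metric hcomp hUo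
    fun y hy => mem_iUnion.2 ⟨⟨y, hy⟩, hyU ⟨y, hy⟩⟩
  refine ⟨r, hr, fun y hy z hz hzy => ?_⟩
  obtain ⟨i, hi⟩ := hball y hy
  exact hU i y (hi (Metric.mem_ball_self hr)) hy z (hi (Metric.mem_ball.2 hzy)) hz

lemma IsTubularRadius.isClosestPoint_closestPoint {Ω : Set (Pt d)} {δ : ℝ}
    (hδ : IsTubularRadius Ω δ) {x : Pt d} (hx : x ∈ tube Ω δ) :
    IsClosestPoint Ω x (closestPoint Ω x) :=
  Classical.epsilon_spec (hδ.2 x hx).exists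

lemma abs_signedDist (Ω : Set (Pt d)) (x : Pt d) :
    |signedDist Ω x| = Metric.infDist x (frontier Ω) := by
  unfold signedDist
  split_ifs
  · rw [abs_neg, abs_of_nonneg Metric.infDist_nonneg]
  · rw [abs_of_nonneg Metric.infDist_nonneg]

/-! ### Clusters of active elements around a cut element -/

/-- If a connected set is covered by finitely many closed sets that all meet it, then their
intersection graph is connected. -/
lemma preconnected_of_isPreconnected_cover {X ι : Type*} [TopologicalSpace X] [Finite ι]
    {S : Set X} (hS : IsPreconnected S) {C : ι → Set X} (hC : ∀ i, IsClosed (C i))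
    (hne : ∀ i, (S ∩ C i).Nonempty) (hcov : S ⊆ ⋃ i, C i) {G : SimpleGraph ι}
    (hG : ∀ i j, i ≠ j → (S ∩ (C i ∩ C j)).Nonempty → G.Adj i j) : G.Preconnected := by
  intro i k
  by_contra hik
  have hclosed : ∀ p : ι → Prop, IsClosed (⋃ j ∈ {j | p j}, C j) := fun p =>
    (Set.toFinite _).isClosed_biUnion fun j _ => hC j
  obtain ⟨x, hxS, hx1, hx2⟩ := isPreconnected_closed_iff.1 hS _ _
    (hclosed fun j => G.Reachable i j) (hclosed fun j => ¬ G.Reachable i j)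
    (fun x hx => by
      obtain ⟨j, hj⟩ := mem_iUnion.1 (hcov hx)
      by_cases h : G.Reachable i j
      · exact Or.inl (mem_iUnion₂.2 ⟨j, h, hj⟩)
      · exact Or.inr (mem_iUnion₂.2 ⟨j, h, hj⟩))
    (by
      obtain ⟨x, hx⟩ := hne i
      exact ⟨x, hx.1, mem_iUnion₂.2 ⟨i, SimpleGraph.Reachable.refl i, hx.2⟩⟩)
    (by
      obtain ⟨x, hx⟩ := hne k
      exact ⟨x, hx.1, mem_iUnion₂.2 ⟨k, hik, hx.2⟩⟩)
  obtain ⟨j, hj, hxj⟩ := mem_iUnion₂.1 hx1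
  obtain ⟨l, hl, hxl⟩ := mem_iUnion₂.1 hx2
  rw [mem_ofPred_eq] at hj hl
  have hjl : j ≠ l := by
    rintro rfl
    exact hl hj
  exact hl (hj.trans (hG j l hjl ⟨x, hxS, hxj, hxl⟩).reachable)

open Classical in
/-- The dual graph of the active mesh: elements are joined if they share a facet. -/
def facetGraph (M : Mesh d) (ρh : Pt d → ℝ) : SimpleGraph (activeBulk M ρh) where
  Adj A B := A ≠ B ∧ ((A : Finset (Pt d)) ∩ (B : Finset (Pt d))).card = d
  symm := ⟨fun A B h => ⟨h.1.symm, by rw [Finset.inter_comm]; exact h.2⟩⟩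
  loopless := ⟨fun _ h => h.1 rfl⟩

section Active

variable {M : Mesh d} {ρh : Pt d → ℝ}

lemma mem_activeBulk_iff {T : Finset (Pt d)} : T ∈ activeBulk M ρh ↔
    T ∈ M.elements ∧ (interior (simplex T) ∩ discreteBulk M ρh).Nonempty := by
  classical
  exact Finset.mem_filter

lemma mem_activeSurface_iff {T : Finset (Pt d)} : T ∈ activeSurface M ρh ↔
    T ∈ activeBulk M ρh ∧ (simplex T ∩ discreteSurface M ρh).Nonempty := by
  classical
  exact Finset.mem_filter

lemma mem_elements_of_mem_activeBulk {T : Finset (Pt d)} (hT : T ∈ activeBulk M ρh) :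
    T ∈ M.elements := (mem_activeBulk_iff.1 hT).1

lemma simplex_subset_domain {T : Finset (Pt d)} (hT : T ∈ M.elements) :
    simplex T ⊆ M.domain := fun _ hx => mem_iUnion₂.2 ⟨T, hT, hx⟩

lemma mem_activeBulk_of_neg (hρ : IsPiecewiseLinear M ρh) {T : Finset (Pt d)}
    (hT : T ∈ M.elements) {y : Pt d} (hy : y ∈ simplex T) (hneg : ρh y < 0) :
    T ∈ activeBulk M ρh := by
  obtain ⟨a, ha⟩ := hρ.2 T hT
  rw [ha hy] at hneg
  obtain ⟨x, hx1, hx2⟩ := mem_closure_iff.1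
    (simplex_subset_closure_interior (M.card_eq T hT) (M.indep T hT) hy) {x | a x < 0}
    (isOpen_lt (continuous_affine a) continuous_const) hneg
  refine mem_activeBulk_iff.2 ⟨hT, x, hx2, simplex_subset_domain hT (interior_subset hx2), ?_⟩
  rw [ha (interior_subset hx2)]
  exact hx1

/-- An active element that does not meet `Γ^h` lies in `Ω^h`. -/
lemma simplex_subset_discreteBulk (hρ : IsPiecewiseLinear M ρh) {T : Finset (Pt d)}
    (hT : T ∈ activeBulk M ρh) (hT' : T ∉ activeSurface M ρh) :
    simplex T ⊆ discreteBulk M ρh := by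
  have hTM := mem_elements_of_mem_activeBulk hT
  obtain ⟨x, hx1, hx2⟩ := (mem_activeBulk_iff.1 hT).2
  have hsub := simplex_subset_domain hTM
  refine fun y hy => ⟨hsub hy, ?_⟩
  by_contra! h
  obtain ⟨z, hz, hz0⟩ := (convex_simplex T).isPreconnected.intermediate_value
    (interior_subset hx1) hy (hρ.1.mono hsub) ⟨hx2.2.le, h⟩
  exact hT' (mem_activeSurface_iff.2 ⟨hT, z, hz, hsub hz, hz0⟩)

/-- A segment that starts in a cut element and runs for a length of ten mesh sizes against the
normal of `Γ` at a nearby point stays in `Ω^h`: at a first zero of `ρh` on it, the gradient of `ρh`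
would point against the normal, although it is close to it wherever `Γ^h` has positive measure.
Its end is too far from `Γ` for the element there to meet `Γ^h`. If the line avoids the
codimension-two skeleton, elements along it that meet do so in facets. -/
lemma exists_cluster (hd : 1 ≤ d) {Ω : Set (Pt d)} {δ₀ C r : ℝ} (hδ : IsTubularRadius Ω δ₀)
    (hflat : ∀ y ∈ frontier Ω, ∀ z ∈ frontier Ω, dist z y < r →
      ‖outwardNormal Ω y‖ = 1 ∧ ‖outwardNormal Ω y - outwardNormal Ω z‖ ≤ 1 / 4 ∧
        |⟪outwardNormal Ω y, z - y⟫| ≤ 1 / 4 * ‖z - y‖)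
    (hcut : IsAdmissibleCut Ω δ₀ C M ρh) (hh : 0 < M.size) (hC : C * M.size ≤ 1 / 4)
    (hr : 15 * M.size < r) (hδh : 15 * M.size < δ₀) (T : activeBulk M ρh)
    (hT : (T : Finset (Pt d)) ∈ activeSurface M ρh) :
    ∃ E : Set (activeBulk M ρh), T ∈ E ∧
      (∃ S ∈ E, (S : Finset (Pt d)) ∉ activeSurface M ρh) ∧
      (∀ S ∈ E, Near (10 * M.size) (simplex (T : Finset (Pt d)))
        (simplex (S : Finset (Pt d)))) ∧
      ((facetGraph M ρh).induce E).Preconnected := by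
  classical
  set h := M.size with hhdef
  have hρ := hcut.piecewiseLinear
  have hproj : ∀ z ∈ discreteSurface M ρh,
      closestPoint Ω z ∈ frontier Ω ∧ dist z (closestPoint Ω z) ≤ h := by
    intro z hz
    have h1 := hδ.isClosestPoint_closestPoint (hcut.surface_subset hz)
    refine ⟨h1.1, ?_⟩
    rw [h1.2, ← abs_signedDist]
    refine (hcut.dist_le z hz).trans ?_
    rw [← hhdef]
    nlinarith
  have hTM := mem_elements_of_mem_activeBulk T.2
  obtain ⟨x₀, hx₀T, hx₀⟩ := (mem_activeSurface_iff.1 hT).2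
  obtain ⟨hy₀, hx₀y₀⟩ := hproj x₀ hx₀
  set y₀ := closestPoint Ω x₀ with hy₀def
  set n₀ := outwardNormal Ω y₀ with hn₀
  have hn₀1 : ‖n₀‖ = 1 := (hflat y₀ hy₀ y₀ hy₀ (by rw [dist_self]; linarith)).1
  obtain ⟨aT, haT⟩ := hρ.2 T hTM
  obtain ⟨x, ⟨hxint, hxneg⟩, hxgen⟩ := M.exists_generic_line (-n₀)
    (U := interior (simplex (T : Finset (Pt d))) ∩ {x | aT x < 0})
    (isOpen_interior.inter (isOpen_lt (continuous_affine aT) continuous_const)) (by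
      obtain ⟨x, hx1, hx2⟩ := (mem_activeBulk_iff.1 T.2).2
      refine ⟨x, hx1, ?_⟩
      rw [mem_ofPred_eq, ← haT (interior_subset hx1)]
      exact hx2.2)
  have hxT : x ∈ simplex (T : Finset (Pt d)) := interior_subset hxint
  set y : ℝ → Pt d := fun t => x + t • -n₀ with hy
  have hycont : Continuous y := by fun_prop
  have hxx₀ : dist x x₀ ≤ h := dist_le_of_mem_simplex (Mesh.diam_le_size hTM) hxT hx₀T
  have hxy : ∀ t, 0 ≤ t → dist x (y t) ≤ t := by
    intro t ht
    rw [dist_eq_norm, hy]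
    simp only [sub_add_cancel_left, norm_neg, norm_smul, hn₀1, Real.norm_eq_abs, mul_one,
      abs_of_nonneg ht, le_refl]
  have hyy₀ : ∀ t ∈ Icc 0 (10 * h), dist (y t) y₀ ≤ 12 * h := by
    intro t ht
    have h1 := hxy t ht.1
    have h2 := dist_triangle4 (y t) x x₀ y₀
    rw [dist_comm (y t) x] at h2
    linarith [ht.2]
  have hdom : ∀ t ∈ Icc 0 (10 * h), y t ∈ M.domain := by
    intro t ht
    refine hcut.covers (Or.inr ?_)
    rw [tube, mem_ofPred_eq, abs_signedDist]
    exact (Metric.infDist_le_dist_of_mem hy₀).trans_lt ((hyy₀ t ht).trans_lt (by linarith))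
  have hclosed : ∀ S : Finset (Pt d), IsClosed {t | y t ∈ simplex S} := fun S =>
    (isCompact_simplex S).isClosed.preimage hycont
  have hprojy₀ : ∀ S ∈ M.elements, ∀ z ∈ simplex S, z ∈ discreteSurface M ρh →
      ∀ t ∈ Icc 0 (10 * h), y t ∈ simplex S → dist (closestPoint Ω z) y₀ ≤ 14 * h ∧
        dist (closestPoint Ω z) (y t) ≤ 2 * h := by
    intro S hS z hzS hz t ht hyS
    have h1 := (hproj z hz).2
    have h2 := dist_le_of_mem_simplex (Mesh.diam_le_size hS) hzS hyS
    have h3 := dist_triangle (closestPoint Ω z) z (y t)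
    rw [dist_comm _ z] at h3
    have h4 := dist_triangle (closestPoint Ω z) (y t) y₀
    have h5 := hyy₀ t ht
    exact ⟨by linarith, by linarith⟩
  have hfcont : ContinuousOn (fun t => ρh (y t)) (Icc 0 (10 * h)) :=
    hρ.1.comp hycont.continuousOn hdom
  have hy0 : y 0 = x := by simp [hy]
  have hneg : ∀ t ∈ Icc 0 (10 * h), ρh (y t) < 0 := by
    by_contra! hcon
    -- `t₁` is the first parameter at which `ρh` is not negative.
    obtain ⟨t₁, ⟨ht₁, hft₁⟩, hmin⟩ : ∃ t₁, IsLeast {t | t ∈ Icc 0 (10 * h) ∧ 0 ≤ ρh (y t)} t₁ := by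
      have hcl : IsClosed {t | t ∈ Icc 0 (10 * h) ∧ 0 ≤ ρh (y t)} :=
        hfcont.preimage_isClosed_of_isClosed isClosed_Icc isClosed_Ici
      exact (isCompact_Icc.of_isClosed_subset hcl fun t ht => ht.1).exists_isLeast hcon
    have hf0 : ρh (y 0) < 0 := by
      rw [hy0, haT hxT]
      exact hxneg
    have ht₁pos : 0 < t₁ := by
      refine lt_of_le_of_ne ht₁.1 ?_
      rintro rfl
      exact absurd hft₁ (not_le.2 hf0)
    have hzero : ρh (y t₁) = 0 := by
      obtain ⟨t, ht, hft⟩ := intermediate_value_Icc ht₁.1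
        (hfcont.mono (Icc_subset_Icc_right ht₁.2)) ⟨hf0.le, hft₁⟩
      have h1 : t₁ ≤ t := hmin ⟨⟨ht.1, ht.2.trans ht₁.2⟩, hft.ge⟩
      rw [le_antisymm h1 ht.2]
      exact hft
    -- Some element contains both the point at `t₁` and a point shortly before.
    obtain ⟨S, hS, t₂, ht₂, ht₂S, ht₁S⟩ : ∃ S ∈ M.elements, ∃ t₂ ∈ Ico 0 t₁,
        y t₂ ∈ simplex S ∧ y t₁ ∈ simplex S := by
      have hKcl : IsClosed (⋃ S ∈ {S ∈ M.elements | y t₁ ∉ simplex S}, {t | y t ∈ simplex S}) :=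
        Set.Finite.isClosed_biUnion (Finset.finite_toSet _) fun S _ => hclosed S
      have hnot : t₁ ∉ ⋃ S ∈ {S ∈ M.elements | y t₁ ∉ simplex S}, {t | y t ∈ simplex S} := by
        intro hmem
        obtain ⟨S, hS, hyS⟩ := mem_iUnion₂.1 hmem
        exact (Finset.mem_filter.1 hS).2 hyS
      have h1 : ∀ᶠ t in 𝓝[<] t₁,
          t ∉ ⋃ S ∈ {S ∈ M.elements | y t₁ ∉ simplex S}, {t | y t ∈ simplex S} :=
        nhdsWithin_le_nhds (hKcl.isOpen_compl.mem_nhds hnot)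
      have h2 : ∀ᶠ t in 𝓝[<] t₁, 0 < t := nhdsWithin_le_nhds (Ioi_mem_nhds ht₁pos)
      have h3 : ∀ᶠ t in 𝓝[<] t₁, t < t₁ := self_mem_nhdsWithin
      obtain ⟨t, ht, ht0', htlt'⟩ := (h1.and (h2.and h3)).exists
      obtain ⟨S, hS, htS⟩ := mem_iUnion₂.1 (hdom t ⟨ht0'.le, htlt'.le.trans ht₁.2⟩)
      refine ⟨S, hS, t, ⟨ht0'.le, htlt'⟩, htS, ?_⟩
      by_contra hno
      exact ht (mem_iUnion₂.2 ⟨S, Finset.mem_filter.2 ⟨hS, hno⟩, htS⟩)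
    have ht₂I : t₂ ∈ Icc 0 (10 * h) := ⟨ht₂.1, ht₂.2.le.trans ht₁.2⟩
    have hft₂ : ρh (y t₂) < 0 := by
      by_contra! hge
      exact absurd (hmin ⟨ht₂I, hge⟩) (not_le.2 ht₂.2)
    obtain ⟨a, ha⟩ := hρ.2 S hS
    have hat₁ : a (y t₁) = 0 := by rw [← ha ht₁S, hzero]
    have hat₂ : a (y t₂) < 0 := by rwa [← ha ht₂S]
    have hslope : ⟪slope a, n₀⟫ < 0 := by
      have h1 := affine_eq_add_inner_slope a (y t₁) (y t₂)
      have h2 : y t₁ - y t₂ = (-(t₁ - t₂)) • n₀ := by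
        simp only [hy]; module
      rw [hat₁, h2, inner_smul_right] at h1
      have h3 : 0 < t₁ - t₂ := sub_pos.2 ht₂.2
      by_contra! hge
      nlinarith
    have hSbulk := mem_activeBulk_of_neg hρ hS ht₂S hft₂
    have hSsurf : S ∈ activeSurface M ρh :=
      mem_activeSurface_iff.2 ⟨hSbulk, y t₁, ht₁S, hdom t₁ ht₁, hzero⟩
    have hset : simplex S ∩ discreteSurface M ρh = simplex S ∩ {x | a x = 0} := by
      ext z
      constructor
      · rintro ⟨hz, hz'⟩
        exact ⟨hz, by rw [mem_ofPred_eq, ← ha hz]; exact hz'.2⟩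
      · rintro ⟨hz, hz'⟩
        exact ⟨hz, simplex_subset_domain hS hz, by rw [ha hz]; exact hz'⟩
    have hmeas : MeasurableSet (simplex S ∩ discreteSurface M ρh) := by
      rw [hset]
      exact ((isCompact_simplex S).isClosed.inter
        (isClosed_eq (continuous_affine a) continuous_const)).measurableSet
    have hpos := M.measure_zeroSet_ne_zero hd hS a ht₁S (hxgen t₁) hat₁ ht₂S hat₂
    rw [← hset] at hpos
    have hne : (ae ((μHE[d - 1] : Measure (Pt d)).restrict
        (simplex S ∩ discreteSurface M ρh))).NeBot :=
      ae_neBot.2 fun h0 => hpos (Measure.restrict_eq_zero.1 h0)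
    obtain ⟨z, hz, hzS, hzΓ⟩ :=
      ((hcut.normal_le S hSsurf a ha).and (ae_restrict_mem hmeas)).exists
    obtain ⟨hd1, -⟩ := hprojy₀ S hS z hzS hzΓ t₁ ht₁ ht₁S
    obtain ⟨-, hn, -⟩ := hflat y₀ hy₀ _ (hproj z hzΓ).1 (hd1.trans_lt (by linarith))
    rw [← hn₀] at hn
    rw [← hhdef] at hz
    have hclose : ‖unitNormal a z - n₀‖ ≤ 1 / 2 := by
      have h1 : unitNormal a z - n₀ = -((n₀ - outwardNormal Ω (closestPoint Ω z)) +
          (outwardNormal Ω (closestPoint Ω z) - unitNormal a z)) := by abel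
      rw [h1, norm_neg]
      exact (norm_add_le _ _).trans (by linarith)
    have h1 : ⟪unitNormal a z, n₀⟫ = 1 + ⟪unitNormal a z - n₀, n₀⟫ := by
      rw [inner_sub_left, real_inner_self_eq_norm_sq, hn₀1]; ring
    have h2 : |⟪unitNormal a z - n₀, n₀⟫| ≤ 1 / 2 := by
      refine (abs_real_inner_le_norm _ _).trans ?_
      rwa [hn₀1, mul_one]
    have h3 : ⟪unitNormal a z, n₀⟫ ≤ 0 := by
      rw [unitNormal, gradient_affine, inner_smul_left]
      exact mul_nonpos_of_nonneg_of_nonpos (by simp) hslope.le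
    linarith [(abs_le.1 h2).1]
  have hactive : ∀ S ∈ M.elements, ∀ t ∈ Icc 0 (10 * h), y t ∈ simplex S → S ∈ activeBulk M ρh :=
    fun S hS t ht hyS => mem_activeBulk_of_neg hρ hS hyS (hneg t ht)
  have hI0 : (0 : ℝ) ∈ Icc 0 (10 * h) := ⟨le_rfl, by positivity⟩
  have hIL : 10 * h ∈ Icc 0 (10 * h) := ⟨by positivity, le_rfl⟩
  let E : Set (activeBulk M ρh) := {S | ∃ t ∈ Icc 0 (10 * h), y t ∈ simplex (S : Finset (Pt d))}
  refine ⟨E, ⟨0, hI0, ?_⟩, ?_, ?_, ?_⟩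
  · rwa [hy0]
  · obtain ⟨S, hS, hyS⟩ := mem_iUnion₂.1 (hdom _ hIL)
    refine ⟨⟨S, hactive S hS _ hIL hyS⟩, ⟨_, hIL, hyS⟩, fun hSsurf => ?_⟩
    obtain ⟨z, hzS, hzΓ⟩ := (mem_activeSurface_iff.1 hSsurf).2
    obtain ⟨hd1, hd2⟩ := hprojy₀ S hS z hzS hzΓ _ hIL hyS
    set p := closestPoint Ω z
    obtain ⟨-, -, hp⟩ := hflat y₀ hy₀ p (hproj z hzΓ).1 (hd1.trans_lt (by linarith))
    rw [← hn₀, ← dist_eq_norm] at hp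
    -- The end of the segment lies at depth about `8h`, so `p` would lie off the tangent plane.
    have hdec : ⟪n₀, p - y₀⟫ = ⟪n₀, p - y (10 * h)⟫ + ⟪n₀, x - x₀⟫ + ⟪n₀, x₀ - y₀⟫ - 10 * h := by
      have h1 : p - y₀ = (p - y (10 * h)) + (x - x₀) + (x₀ - y₀) - (10 * h) • n₀ := by
        simp only [hy]; module
      rw [h1, inner_sub_right, inner_add_right, inner_add_right, inner_smul_right,
        real_inner_self_eq_norm_sq, hn₀1]
      ring
    have hle : ∀ u v : Pt d, ⟪n₀, u - v⟫ ≤ dist u v := by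
      intro u v
      rw [dist_eq_norm]
      simpa [hn₀1] using real_inner_le_norm n₀ (u - v)
    have h1 := hle p (y (10 * h))
    have h2 := hle x x₀
    have h3 := hle x₀ y₀
    have h4 := (abs_le.1 hp).1
    linarith
  · rintro S ⟨t, ht, hyS⟩
    exact ⟨x, hxT, y t, hyS, (hxy t ht.1).trans ht.2⟩
  · refine preconnected_of_isPreconnected_cover (ι := E) (S := Icc 0 (10 * h)) isPreconnected_Icc
      (C := fun S => {t | y t ∈ simplex ((S : activeBulk M ρh) : Finset (Pt d))})
      (fun S => hclosed _) ?_ ?_ ?_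
    · rintro ⟨S, t, ht, hyS⟩
      exact ⟨t, ht, hyS⟩
    · intro t ht
      obtain ⟨S, hS, hyS⟩ := mem_iUnion₂.1 (hdom t ht)
      exact mem_iUnion.2 ⟨⟨⟨S, hactive S hS t ht hyS⟩, t, ht, hyS⟩, hyS⟩
    · rintro ⟨A, hA⟩ ⟨B, hB⟩ hAB ⟨t, ht, htA, htB⟩
      have hne : A ≠ B := fun e => hAB (Subtype.ext e)
      have hAM := mem_elements_of_mem_activeBulk A.2
      have hBM := mem_elements_of_mem_activeBulk B.2
      refine ⟨hne, ?_⟩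
      have hmem : y t ∈ convexHull ℝ (((A : Finset (Pt d)) : Set (Pt d)) ∩
          ((B : Finset (Pt d)) : Set (Pt d))) := by
        rw [← M.conforming _ hAM _ hBM]
        exact ⟨htA, htB⟩
      rw [← Finset.coe_inter] at hmem
      have h1 : d ≤ ((A : Finset (Pt d)) ∩ (B : Finset (Pt d))).card := by
        by_contra! hlt
        exact hxgen t _ hAM _ Finset.inter_subset_left hlt hmem
      have h2 : ((A : Finset (Pt d)) ∩ (B : Finset (Pt d))).card < d + 1 := by
        rw [← M.card_eq _ hAM]
        refine Finset.card_lt_card (Finset.ssubset_iff_subset_ne.2 ⟨Finset.inter_subset_left, ?_⟩)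
        intro heq
        refine hne (Subtype.ext (Finset.eq_of_subset_of_card_le (Finset.inter_eq_left.1 heq) ?_))
        rw [M.card_eq _ hAM, M.card_eq _ hBM]
      change ((A : Finset (Pt d)) ∩ (B : Finset (Pt d))).card = d
      omega

end Active

/-! ### Faces of the active mesh and the forms for one function -/

section Forms

variable {M : Mesh d} {ρh : Pt d → ℝ}

/-- `‖∇v‖²` on the physical part of the element `T`. -/
def elementEnergy (v : BulkSpace M ρh) (T : activeBulk M ρh) : ℝ :=
  ‖slope (v T)‖ ^ 2 *
    (volume : Measure (Pt d)).real (simplex (T : Finset (Pt d)) ∩ discreteBulk M ρh)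

/-- `‖[v]‖²` on a face. -/
def jumpSq (v : BulkSpace M ρh) (p : ActivePair M ρh) : ℝ :=
  ∫ x in face p, jump v p x ^ 2 ∂μHE[d - 1]

/-- `‖n_F · [∇v]‖²` on a face. -/
def gradJumpSq (v : BulkSpace M ρh) (p : ActivePair M ρh) : ℝ :=
  ⟪faceNormal p, slope (v p.1) - slope (v p.2)⟫ ^ 2 * (μHE[d - 1]).real (face p)

lemma elementEnergy_nonneg (v : BulkSpace M ρh) (T : activeBulk M ρh) :
    0 ≤ elementEnergy v T := by unfold elementEnergy; positivity

lemma jumpSq_nonneg (v : BulkSpace M ρh) (p : ActivePair M ρh) : 0 ≤ jumpSq v p :=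
  integral_nonneg fun _ => sq_nonneg _

lemma gradJumpSq_nonneg (v : BulkSpace M ρh) (p : ActivePair M ρh) : 0 ≤ gradJumpSq v p := by
  unfold gradJumpSq; positivity

lemma gradForm_self (v : BulkSpace M ρh) :
    gradForm M ρh v v = ∑ T, elementEnergy v T := by
  refine Finset.sum_congr rfl fun T _ => ?_
  simp only [gradient_affine, real_inner_self_eq_norm_sq, setIntegral_const, smul_eq_mul,
    elementEnergy]
  rw [mul_comm]

lemma massForm_self_nonneg (v : BulkSpace M ρh) : 0 ≤ massForm M ρh v v :=
  Finset.sum_nonneg fun _ _ => integral_nonneg fun _ => mul_self_nonneg _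

lemma jumpForm_self (v : BulkSpace M ρh) :
    jumpForm M ρh v v = ∑ p ∈ bulkFaces M ρh, M.size⁻¹ * jumpSq v p := by
  refine Finset.sum_congr rfl fun p _ => ?_
  rw [jumpSq, ← integral_const_mul]
  congr 1 with x
  ring

lemma ghostForm_self (μ τ : ℝ) (v : BulkSpace M ρh) :
    ghostForm M ρh μ τ v v = μ * M.size⁻¹ * (∑ p ∈ ghostFaces M ρh, jumpSq v p) +
      τ * ∑ p ∈ ghostFaces M ρh, M.size * gradJumpSq v p := by
  rw [ghostForm, ← Finset.mul_sum, ← mul_assoc]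
  congr 2
  · refine Finset.sum_congr rfl fun p _ => ?_
    simp only [jumpSq, sq]
  · refine Finset.sum_congr rfl fun p _ => ?_
    simp only [gradJump, gradient_affine, setIntegral_const, smul_eq_mul, gradJumpSq]
    ring

open Classical in
lemma mem_bulkFaces_iff {p : ActivePair M ρh} : p ∈ bulkFaces M ρh ↔
    WellOrderingRel p.1 p.2 ∧ ((p.1 : Finset (Pt d)) ∩ (p.2 : Finset (Pt d))).card = d := by
  simp [bulkFaces]

lemma mem_ghostFaces_iff {p : ActivePair M ρh} : p ∈ ghostFaces M ρh ↔ p ∈ bulkFaces M ρh ∧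
    ((p.1 : Finset (Pt d)) ∈ activeSurface M ρh ∨ (p.2 : Finset (Pt d)) ∈ activeSurface M ρh) := by
  classical
  exact Finset.mem_filter

lemma isCompact_face (p : ActivePair M ρh) : IsCompact (face p) :=
  (isCompact_simplex _).inter (isCompact_simplex _)

lemma face_nonempty (hd : 1 ≤ d) {p : ActivePair M ρh} (hp : p ∈ bulkFaces M ρh) :
    (face p).Nonempty := by
  classical
  obtain ⟨x, hx⟩ : ((p.1 : Finset (Pt d)) ∩ (p.2 : Finset (Pt d))).Nonempty := by
    rw [← Finset.card_pos, (mem_bulkFaces_iff.1 hp).2]; omega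
  rw [Finset.mem_inter] at hx
  exact ⟨x, subset_convexHull ℝ _ hx.1, subset_convexHull ℝ _ hx.2⟩

/-- The constant in the bound of the gradient jump by the face terms. -/
def jumpConst (d : ℕ) (θ : ℝ) : ℝ :=
  min (discVolume d * θ ^ (d - 1)) (discVolume d * (θ / 4) ^ (d + 1))

variable {θ : ℝ} (hd : 1 ≤ d) (hθ : 0 < θ) (hh : 0 < M.size)
  (hball : ∀ T ∈ M.elements, ∃ x, Metric.closedBall x (θ * M.size) ⊆ simplex T)

include hd hθ hh hball

lemma face_between_discs {p : ActivePair M ρh} (hp : p ∈ bulkFaces M ρh) :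
    ‖faceNormal p‖ = 1 ∧ (∃ c, hyperDisc (faceNormal p) c (θ * M.size) ⊆ face p) ∧
      ∃ c, face p ⊆ hyperDisc (faceNormal p) c M.size := by
  classical
  have h1 := mem_elements_of_mem_activeBulk p.1.2
  have h2 := mem_elements_of_mem_activeBulk p.2.2
  obtain ⟨x₀, hx₀⟩ := hball _ h1
  have := facet_between_discs (B := p.2) (M.card_eq _ h1) (M.indep _ h1) hd (mem_bulkFaces_iff.1 hp).2
    (mul_pos hθ hh) hx₀ (Mesh.diam_le_size h1)
  rwa [← M.conforming _ h1 _ h2] at this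

lemma measure_face_bounds {p : ActivePair M ρh} (hp : p ∈ bulkFaces M ρh) :
    μHE[d - 1] (face p) ≠ ⊤ ∧
    discVolume d * (θ * M.size) ^ (d - 1) ≤ (μHE[d - 1]).real (face p) ∧
    (μHE[d - 1]).real (face p) ≤ discVolume d * M.size ^ (d - 1) := by
  obtain ⟨hν, ⟨c, hc⟩, c', hc'⟩ := face_between_discs hd hθ hh hball hp
  have hν0 : faceNormal p ≠ 0 := by
    intro h
    rw [h, norm_zero] at hν
    exact zero_ne_one hν
  have hup := measure_mono (μ := (μHE[d - 1] : Measure (Pt d))) hc'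
  have hlow := measure_mono (μ := (μHE[d - 1] : Measure (Pt d))) hc
  rw [measure_hyperDisc hν0 _ hh.le] at hup
  rw [measure_hyperDisc hν0 _ (by positivity)] at hlow
  have htop : μHE[d - 1] (face p) ≠ ⊤ := ne_top_of_le_ne_top ENNReal.ofReal_ne_top hup
  exact ⟨htop, (ENNReal.ofReal_le_iff_le_toReal htop).1 hlow,
    ENNReal.toReal_le_of_le_ofReal (mul_nonneg discVolume_pos.le (by positivity)) hup⟩

/-- The normal part of the jump of the gradient is penalized, and the tangential part is controlled
by the jump of the function through the inverse inequality on the face. -/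
lemma jumpConst_mul_le (v : BulkSpace M ρh) {p : ActivePair M ρh} (hp : p ∈ bulkFaces M ρh) :
    jumpConst d θ * (M.size ^ d * ‖slope (v p.1) - slope (v p.2)‖ ^ 2) ≤
      M.size * gradJumpSq v p + M.size⁻¹ * jumpSq v p := by
  obtain ⟨hν, ⟨c, hc⟩, -⟩ := face_between_discs hd hθ hh hball hp
  obtain ⟨htop, hlow, -⟩ := measure_face_bounds hd hθ hh hball hp
  set h := M.size
  set ν := faceNormal p
  set g := slope (v p.1) - slope (v p.2) with hg
  have hpow : h ^ d = h ^ (d - 1) * h := by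
    rw [← pow_succ]; congr 1; omega
  have hω := discVolume_pos (d := d)
  have h1 : discVolume d * θ ^ (d - 1) * (h ^ d * ⟪ν, g⟫ ^ 2) ≤ h * gradJumpSq v p := by
    calc discVolume d * θ ^ (d - 1) * (h ^ d * ⟪ν, g⟫ ^ 2)
        = h * (⟪ν, g⟫ ^ 2 * (discVolume d * (θ * h) ^ (d - 1))) := by rw [hpow, mul_pow]; ring
      _ ≤ h * gradJumpSq v p := by
          unfold gradJumpSq
          gcongr
  have h2 : discVolume d * (θ / 4) ^ (d + 1) * (h ^ d * ‖tangential ν g‖ ^ 2) ≤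
      h⁻¹ * jumpSq v p := by
    have hinv := le_integral_sq_of_hyperDisc_subset hν (by positivity) (isCompact_face p) htop hc
      (v p.1 - v p.2)
    rw [slope_sub, ← hg] at hinv
    have hJ : ∫ x in face p, (v p.1 - v p.2) x ^ 2 ∂μHE[d - 1] = jumpSq v p := rfl
    rw [hJ] at hinv
    calc discVolume d * (θ / 4) ^ (d + 1) * (h ^ d * ‖tangential ν g‖ ^ 2)
        = h⁻¹ * (discVolume d * (θ * h / 4) ^ (d - 1) *
          (‖tangential ν g‖ * (θ * h / 4)) ^ 2) := by
          have e1 : d + 1 = (d - 1) + 2 := by omega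
          have e2 : θ * h / 4 = θ / 4 * h := by ring
          rw [hpow, e1, pow_add, e2, mul_pow (θ / 4) h]
          field_simp
      _ ≤ h⁻¹ * jumpSq v p := by gcongr
  rw [norm_sq_eq_normal_add_tangential hν g, mul_add, mul_add]
  refine add_le_add (le_trans ?_ h1) (le_trans ?_ h2)
  · gcongr; exact min_le_left _ _
  · gcongr; exact min_le_right _ _

omit hd hθ hh hball in
lemma integrableOn_face {p : ActivePair M ρh} (htop : μHE[d - 1] (face p) ≠ ⊤) {f : Pt d → ℝ}
    (hf : Continuous f) : IntegrableOn f (face p) μHE[d - 1] :=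
  hf.continuousOn.integrableOn_of_subset_isCompact (isCompact_face p)
    (isCompact_face p).measurableSet subset_rfl htop

/-- Young's inequality for the flux term on one face. -/
lemma two_mul_abs_flux_le (v : BulkSpace M ρh) {p : ActivePair M ρh} (hp : p ∈ bulkFaces M ρh)
    {ε : ℝ} (hε : 0 < ε) :
    2 * |∫ x in face p ∩ discreteBulk M ρh, meanFlux v p x * jump v p x ∂μHE[d - 1]| ≤
      ε * discVolume d * M.size ^ d * ((‖slope (v p.1)‖ ^ 2 + ‖slope (v p.2)‖ ^ 2) / 2) +
        ε⁻¹ * (M.size⁻¹ * jumpSq v p) := by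
  obtain ⟨hν, -, -⟩ := face_between_discs hd hθ hh hball hp
  obtain ⟨htop, -, hup⟩ := measure_face_bounds hd hθ hh hball hp
  set h := M.size
  set m := 1 / 2 * ⟪faceNormal p, slope (v p.1) + slope (v p.2)⟫ with hm
  have hmean : ∀ x, meanFlux v p x = m := fun x => by simp only [meanFlux, gradient_affine, hm]
  have hjc : Continuous (jump v p) := (continuous_affine (v p.1)).sub (continuous_affine (v p.2))
  have hint1 := integrableOn_face htop
    (continuous_const.mul hjc.norm : Continuous fun x => |m| * ‖jump v p x‖)
  have hint3 : IntegrableOn (fun _ : Pt d => 1 / 2 * (ε * h * m ^ 2)) (face p) μHE[d - 1] :=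
    integrableOn_face htop continuous_const
  have hint4 : IntegrableOn (fun x => 1 / 2 * (ε⁻¹ * h⁻¹) * jump v p x ^ 2) (face p)
      μHE[d - 1] := integrableOn_face htop (continuous_const.mul (hjc.pow 2))
  have hpow : h ^ d = h * h ^ (d - 1) := by
    rw [← pow_succ']; congr 1; omega
  have hm2 : m ^ 2 ≤ (‖slope (v p.1)‖ ^ 2 + ‖slope (v p.2)‖ ^ 2) / 2 := by
    have h1 : |m| ≤ 1 / 2 * (‖slope (v p.1)‖ + ‖slope (v p.2)‖) := by
      rw [hm, abs_mul, abs_of_pos (by norm_num : (0 : ℝ) < 1 / 2)]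
      gcongr
      refine (abs_real_inner_le_norm _ _).trans ?_
      rw [hν, one_mul]
      exact norm_add_le _ _
    rw [← sq_abs]
    calc |m| ^ 2 ≤ (1 / 2 * (‖slope (v p.1)‖ + ‖slope (v p.2)‖)) ^ 2 := by gcongr
      _ ≤ _ := by nlinarith [sq_nonneg (‖slope (v p.1)‖ - ‖slope (v p.2)‖)]
  have hpt : ∀ x, |m| * ‖jump v p x‖ ≤
      1 / 2 * (ε * h * m ^ 2) + 1 / 2 * (ε⁻¹ * h⁻¹) * jump v p x ^ 2 := by
    intro x
    have hεh : 0 < ε * h := mul_pos hε hh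
    have e : ε⁻¹ * h⁻¹ = (ε * h)⁻¹ := (mul_inv _ _).symm
    rw [e, Real.norm_eq_abs, ← sq_abs m, ← sq_abs (jump v p x)]
    set A := |m|
    set B := |jump v p x|
    have key : 0 ≤ (ε * h)⁻¹ * (ε * h * A - B) ^ 2 := by positivity
    have e2 : (ε * h)⁻¹ * (ε * h * A - B) ^ 2 =
        ε * h * A ^ 2 - 2 * (A * B) + (ε * h)⁻¹ * B ^ 2 := by
      field_simp
      ring
    rw [e2] at key
    linarith
  have hbound : |∫ x in face p ∩ discreteBulk M ρh, meanFlux v p x * jump v p x ∂μHE[d - 1]| ≤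
      1 / 2 * (ε * h * m ^ 2) * (μHE[d - 1]).real (face p) +
        1 / 2 * (ε⁻¹ * h⁻¹) * jumpSq v p := by
    calc |∫ x in face p ∩ discreteBulk M ρh, meanFlux v p x * jump v p x ∂μHE[d - 1]|
        ≤ ∫ x in face p ∩ discreteBulk M ρh, |m| * ‖jump v p x‖ ∂μHE[d - 1] := by
          rw [← Real.norm_eq_abs]
          refine (norm_integral_le_integral_norm _).trans_eq ?_
          congr 1 with x
          rw [hmean, norm_mul, Real.norm_eq_abs m]
      _ ≤ ∫ x in face p, |m| * ‖jump v p x‖ ∂μHE[d - 1] :=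
          setIntegral_mono_set hint1 (ae_of_all _ fun x => by positivity)
            inter_subset_left.eventuallyLE
      _ ≤ ∫ x in face p, (1 / 2 * (ε * h * m ^ 2) + 1 / 2 * (ε⁻¹ * h⁻¹) * jump v p x ^ 2)
            ∂μHE[d - 1] :=
          setIntegral_mono hint1 (hint3.add hint4) hpt
      _ = _ := by
          rw [integral_add hint3 hint4, setIntegral_const,
            integral_const_mul, smul_eq_mul, mul_comm ((μHE[d - 1]).real (face p))]
          rfl
  have hfirst : ε * h * m ^ 2 * (μHE[d - 1]).real (face p) ≤
      ε * discVolume d * h ^ d * ((‖slope (v p.1)‖ ^ 2 + ‖slope (v p.2)‖ ^ 2) / 2) := by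
    calc ε * h * m ^ 2 * (μHE[d - 1]).real (face p)
        ≤ ε * h * ((‖slope (v p.1)‖ ^ 2 + ‖slope (v p.2)‖ ^ 2) / 2) *
          (discVolume d * h ^ (d - 1)) := by gcongr
      _ = _ := by rw [hpow]; ring
  have := mul_le_mul_of_nonneg_left hbound (zero_le_two (α := ℝ))
  refine this.trans (le_trans (le_of_eq ?_) (add_le_add_left hfirst _))
  ring

end Forms

/-! ### The gradient on the full active mesh -/

/-- On a connected graph, a function whose increments along edges are at most `B` varies by at most
the number of vertices times `B`. -/
lemma norm_sub_le_of_preconnected {ι V : Type*} [Fintype ι] [SeminormedAddCommGroup V]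
    {G : SimpleGraph ι} (hG : G.Preconnected) (f : ι → V) {B : ℝ} (hB : 0 ≤ B)
    (h : ∀ i j, G.Adj i j → ‖f i - f j‖ ≤ B) (i j : ι) :
    ‖f i - f j‖ ≤ Fintype.card ι * B := by
  classical
  have hwalk : ∀ {i j : ι} (p : G.Walk i j), ‖f i - f j‖ ≤ p.length * B := by
    intro i j p
    induction p with
    | nil => simp
    | @cons u w z hadj q ih =>
      have h1 := norm_sub_le_norm_sub_add_norm_sub (f u) (f w) (f z)
      have h2 := h _ _ hadj
      rw [SimpleGraph.Walk.length_cons]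
      push_cast
      linarith
  obtain ⟨p, hp⟩ := (hG i j).exists_isPath
  refine (hwalk p).trans ?_
  gcongr
  exact_mod_cast hp.length_lt.le

/-- Exchange of summation for a relation in which each element has at most `N` partners. -/
lemma sum_sum_filter_le {α β : Type*} [Fintype α] (s : Finset β) (R : α → β → Prop)
    [∀ a, DecidablePred (R a)] [∀ b, DecidablePred fun a => R a b] {Y : β → ℝ} (hY : ∀ b, 0 ≤ Y b)
    {N : ℝ} (hN : ∀ b ∈ s, ((Finset.univ.filter fun a => R a b).card : ℝ) ≤ N) :
    ∑ a, ∑ b ∈ s.filter (R a), Y b ≤ N * ∑ b ∈ s, Y b := by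
  simp_rw [Finset.sum_filter]
  rw [Finset.sum_comm, Finset.mul_sum]
  refine Finset.sum_le_sum fun b hb => ?_
  rw [← Finset.sum_filter, Finset.sum_const, nsmul_eq_mul]
  exact mul_le_mul_of_nonneg_right (hN b hb) (hY b)

section Gradient

variable {M : Mesh d} {ρh : Pt d → ℝ}

/-- Two active elements have points at distance at most ten mesh sizes. -/
def NearElements (S T : activeBulk M ρh) : Prop :=
  Near (10 * M.size) (simplex (S : Finset (Pt d))) (simplex (T : Finset (Pt d)))

lemma NearElements.symm {S T : activeBulk M ρh} (h : NearElements S T) : NearElements T S :=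
  Near.symm h

/-- The bound for the number of elements near a given one. -/
def nearCard (d : ℕ) (θ : ℝ) : ℝ := (12 / θ) ^ d

lemma nearCard_pos {θ : ℝ} (hθ : 0 < θ) : 0 < nearCard d θ := by unfold nearCard; positivity

/-- The constant in the local estimates of the gradient; the quarter leaves room for the triangle
inequality between two elements in `Ω^h`. -/
def localConst (d : ℕ) (θ : ℝ) : ℝ :=
  min (jumpConst d θ) (θ ^ d * (volume : Measure (Pt d)).real (Metric.ball 0 1) / 4)

/-- The constant in the bound for the gradient on the full active mesh. -/
def gradientConst (d : ℕ) (θ τ : ℝ) : ℝ :=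
  (localConst d θ)⁻¹ * (1 + nearCard d θ) ^ 2 * nearCard d θ * (1 + τ⁻¹)

variable {θ : ℝ} (hd : 1 ≤ d) (hθ : 0 < θ) (hh : 0 < M.size)
  (hball : ∀ T ∈ M.elements, ∃ x, Metric.closedBall x (θ * M.size) ⊆ simplex T)

include hθ hh hball

open Classical in
lemma card_nearElements_le (T : activeBulk M ρh) :
    ((Finset.univ.filter fun S => NearElements T S).card : ℝ) ≤ nearCard d θ := by
  have h1 := Mesh.card_near_le hθ hh (by norm_num : (0 : ℝ) ≤ 10) hball
    (mem_elements_of_mem_activeBulk T.2)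
    ((Finset.univ.filter fun S => NearElements T S).map (Function.Embedding.subtype _))
    (fun S hS => by
      obtain ⟨S', -, rfl⟩ := Finset.mem_map.1 hS
      exact mem_elements_of_mem_activeBulk S'.2)
    (fun S hS => by
      obtain ⟨S', hS', rfl⟩ := Finset.mem_map.1 hS
      exact (Finset.mem_filter.1 hS').2)
  rw [Finset.card_map] at h1
  refine h1.trans_eq ?_
  norm_num [nearCard]

open Classical in
lemma card_nearElements_le' (T : activeBulk M ρh) :
    ((Finset.univ.filter fun S => NearElements S T).card : ℝ) ≤ nearCard d θ := by
  rw [Finset.filter_congr fun S _ => ⟨NearElements.symm, NearElements.symm⟩]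
  exact card_nearElements_le hθ hh hball T

omit hθ hh hball in
open Classical in
/-- The contributions to the energy and to the face terms from the vicinity of `T`. -/
def localEnergy (v : BulkSpace M ρh) (T : activeBulk M ρh) : ℝ :=
  ∑ S ∈ Finset.univ.filter (NearElements T), elementEnergy v S +
    ∑ p ∈ (bulkFaces M ρh).filter (fun p => NearElements T p.1), M.size⁻¹ * jumpSq v p +
    ∑ p ∈ (ghostFaces M ρh).filter (fun p => NearElements T p.1), M.size * gradJumpSq v p

omit hθ hball in
lemma elementEnergy_le_localEnergy (v : BulkSpace M ρh) {T S : activeBulk M ρh}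
    (hTS : NearElements T S) : elementEnergy v S ≤ localEnergy v T := by
  classical
  have h1 := Finset.single_le_sum (f := elementEnergy v) (fun S _ => elementEnergy_nonneg v S)
    (Finset.mem_filter.2 ⟨Finset.mem_univ S, hTS⟩)
  have h2 : 0 ≤ ∑ p ∈ (bulkFaces M ρh).filter (fun p => NearElements T p.1),
      M.size⁻¹ * jumpSq v p :=
    Finset.sum_nonneg fun p _ => mul_nonneg (inv_pos.2 hh).le (jumpSq_nonneg v p)
  have h3 : 0 ≤ ∑ p ∈ (ghostFaces M ρh).filter (fun p => NearElements T p.1),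
      M.size * gradJumpSq v p :=
    Finset.sum_nonneg fun p _ => mul_nonneg hh.le (gradJumpSq_nonneg v p)
  unfold localEnergy
  convert (h1.trans (le_add_of_nonneg_right h2)).trans (le_add_of_nonneg_right h3)

omit hθ hball in
lemma face_terms_le_localEnergy (v : BulkSpace M ρh) {T : activeBulk M ρh}
    {p : ActivePair M ρh} (hp : p ∈ ghostFaces M ρh) (hTp : NearElements T p.1) :
    M.size * gradJumpSq v p + M.size⁻¹ * jumpSq v p ≤ localEnergy v T := by
  classical
  have h1 : 0 ≤ ∑ S ∈ Finset.univ.filter (NearElements T), elementEnergy v S :=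
    Finset.sum_nonneg fun S _ => elementEnergy_nonneg v S
  have h2 := Finset.single_le_sum (f := fun p => M.size⁻¹ * jumpSq v p)
    (fun p _ => mul_nonneg (inv_pos.2 hh).le (jumpSq_nonneg v p))
    (Finset.mem_filter (p := fun p => NearElements T p.1).2 ⟨(mem_ghostFaces_iff.1 hp).1, hTp⟩)
  have h3 := Finset.single_le_sum (f := fun p => M.size * gradJumpSq v p)
    (fun p _ => mul_nonneg hh.le (gradJumpSq_nonneg v p))
    (Finset.mem_filter (p := fun p => NearElements T p.1).2 ⟨hp, hTp⟩)
  have h4 := add_le_add (add_le_add h1 h2) h3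
  unfold localEnergy
  refine le_trans (le_of_eq ?_) (h4.trans_eq ?_)
  · ring
  · congr

omit hh hball in
lemma localConst_pos : 0 < localConst d θ := by
  have hω := discVolume_pos (d := d)
  have hβ : 0 < (volume : Measure (Pt d)).real (Metric.ball 0 1) :=
    ENNReal.toReal_pos (Metric.measure_ball_pos _ _ one_pos).ne' measure_ball_lt_top.ne
  refine lt_min (lt_min ?_ ?_) ?_ <;> positivity

lemma localConst_mul_le_elementEnergy (hρ : IsPiecewiseLinear M ρh) (v : BulkSpace M ρh)
    {T : activeBulk M ρh} (hT : (T : Finset (Pt d)) ∉ activeSurface M ρh) :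
    4 * (localConst d θ * M.size ^ d * ‖slope (v T)‖ ^ 2) ≤ elementEnergy v T := by
  obtain ⟨x, hx⟩ := hball T (mem_elements_of_mem_activeBulk T.2)
  have hsub := simplex_subset_discreteBulk hρ T.2 hT
  have hvol : θ ^ d * (volume : Measure (Pt d)).real (Metric.ball 0 1) * M.size ^ d ≤
      (volume : Measure (Pt d)).real (simplex (T : Finset (Pt d)) ∩ discreteBulk M ρh) := by
    rw [inter_eq_left.2 hsub]
    have h1 := measureReal_mono (μ := (volume : Measure (Pt d))) hx
      (isCompact_simplex _).measure_lt_top.ne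
    refine le_trans (le_of_eq ?_) h1
    rw [Measure.real, Measure.real, Measure.addHaar_closedBall _ _ (by positivity),
      ENNReal.toReal_mul, ENNReal.toReal_ofReal (by positivity)]
    simp only [finrank_euclideanSpace, Fintype.card_fin]
    ring
  have hc : localConst d θ ≤ θ ^ d * (volume : Measure (Pt d)).real (Metric.ball 0 1) / 4 :=
    min_le_right _ _
  unfold elementEnergy
  calc 4 * (localConst d θ * M.size ^ d * ‖slope (v T)‖ ^ 2)
      ≤ 4 * (θ ^ d * (volume : Measure (Pt d)).real (Metric.ball 0 1) / 4 * M.size ^ d *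
        ‖slope (v T)‖ ^ 2) := by gcongr
    _ = ‖slope (v T)‖ ^ 2 *
        (θ ^ d * (volume : Measure (Pt d)).real (Metric.ball 0 1) * M.size ^ d) := by ring
    _ ≤ _ := by gcongr

include hd

lemma localConst_mul_sub_le_of_ghost (v : BulkSpace M ρh) {T : activeBulk M ρh}
    {p : ActivePair M ρh} (hp : p ∈ ghostFaces M ρh) (hTp : NearElements T p.1) :
    localConst d θ * M.size ^ d * ‖slope (v p.1) - slope (v p.2)‖ ^ 2 ≤ localEnergy v T := by
  refine le_trans ?_ ((jumpConst_mul_le hd hθ hh hball v (mem_ghostFaces_iff.1 hp).1).trans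
    (face_terms_le_localEnergy hh v hp hTp))
  rw [mul_assoc]
  gcongr
  exact min_le_left _ _

/-- The gradient varies little across a common facet of two active elements: the face carries the
ghost penalty, or both elements lie in `Ω^h`. -/
lemma localConst_mul_sub_le (hρ : IsPiecewiseLinear M ρh) (v : BulkSpace M ρh)
    {T A B : activeBulk M ρh} (hA : NearElements T A) (hB : NearElements T B)
    (hAB : (facetGraph M ρh).Adj A B) :
    localConst d θ * M.size ^ d * ‖slope (v A) - slope (v B)‖ ^ 2 ≤ localEnergy v T := by
  classical
  by_cases hcut : (A : Finset (Pt d)) ∈ activeSurface M ρh ∨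
      (B : Finset (Pt d)) ∈ activeSurface M ρh
  · have hcard := hAB.2
    rcases trichotomous_of (WellOrderingRel (α := activeBulk M ρh)) A B with h | h | h
    · exact localConst_mul_sub_le_of_ghost hd hθ hh hball v (p := (A, B))
        (mem_ghostFaces_iff.2 ⟨mem_bulkFaces_iff.2 ⟨h, hcard⟩, hcut⟩) hA
    · exact absurd h hAB.1
    · rw [norm_sub_rev]
      refine localConst_mul_sub_le_of_ghost hd hθ hh hball v (p := (B, A))
        (mem_ghostFaces_iff.2 ⟨mem_bulkFaces_iff.2 ⟨h, ?_⟩, hcut.symm⟩) hB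
      rw [Finset.inter_comm]
      exact hcard
  · rw [not_or] at hcut
    have h1 := (localConst_mul_le_elementEnergy hθ hh hball hρ v hcut.1).trans
      (elementEnergy_le_localEnergy hh v hA)
    have h2 := (localConst_mul_le_elementEnergy hθ hh hball hρ v hcut.2).trans
      (elementEnergy_le_localEnergy hh v hB)
    have h3 : ‖slope (v A) - slope (v B)‖ ^ 2 ≤ 2 * ‖slope (v A)‖ ^ 2 + 2 * ‖slope (v B)‖ ^ 2 := by
      have := norm_sub_le (slope (v A)) (slope (v B))
      calc ‖slope (v A) - slope (v B)‖ ^ 2 ≤ (‖slope (v A)‖ + ‖slope (v B)‖) ^ 2 := by gcongr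
        _ ≤ _ := by nlinarith [sq_nonneg (‖slope (v A)‖ - ‖slope (v B)‖)]
    have h4 : 0 < localConst d θ * M.size ^ d := mul_pos (localConst_pos hθ) (pow_pos hh d)
    nlinarith [mul_le_mul_of_nonneg_left h3 h4.le]

/-- The gradient on an active element is controlled by the local energy: along the facets of a
cluster it is compared with the gradient on an element contained in `Ω^h`. -/
lemma gradient_le_localEnergy (hρ : IsPiecewiseLinear M ρh)
    (hcluster : ∀ T : activeBulk M ρh, (T : Finset (Pt d)) ∈ activeSurface M ρh →
      ∃ E : Set (activeBulk M ρh), T ∈ E ∧ (∃ S ∈ E, (S : Finset (Pt d)) ∉ activeSurface M ρh) ∧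
        (∀ S ∈ E, NearElements T S) ∧ ((facetGraph M ρh).induce E).Preconnected)
    (v : BulkSpace M ρh) (T : activeBulk M ρh) :
    localConst d θ * M.size ^ d * ‖slope (v T)‖ ^ 2 ≤
      (1 + nearCard d θ) ^ 2 * localEnergy v T := by
  classical
  have hα : 0 < localConst d θ * M.size ^ d := mul_pos (localConst_pos hθ) (pow_pos hh d)
  have hN := nearCard_pos (d := d) hθ
  have huncut : ∀ S : activeBulk M ρh, (S : Finset (Pt d)) ∉ activeSurface M ρh →
      NearElements T S → localConst d θ * M.size ^ d * ‖slope (v S)‖ ^ 2 ≤ localEnergy v T := by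
    intro S hS hTS
    have h1 := (localConst_mul_le_elementEnergy hθ hh hball hρ v hS).trans
      (elementEnergy_le_localEnergy hh v hTS)
    have h2 : 0 ≤ localConst d θ * M.size ^ d * ‖slope (v S)‖ ^ 2 := by positivity
    linarith
  have hself : NearElements T T := by
    obtain ⟨x, hx⟩ := hball T (mem_elements_of_mem_activeBulk T.2)
    have := hx (Metric.mem_closedBall_self (by positivity))
    exact ⟨x, this, x, this, by rw [dist_self]; positivity⟩
  have hQ : 0 ≤ localEnergy v T :=
    (elementEnergy_nonneg v T).trans (elementEnergy_le_localEnergy hh v hself)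
  by_cases hT : (T : Finset (Pt d)) ∈ activeSurface M ρh
  · obtain ⟨E, hTE, ⟨S, hSE, hS⟩, hnear, hconn⟩ := hcluster T hT
    set B := √(localEnergy v T / (localConst d θ * M.size ^ d)) with hBdef
    have hB0 : 0 ≤ B := Real.sqrt_nonneg _
    have hle : ∀ w : Pt d, localConst d θ * M.size ^ d * ‖w‖ ^ 2 ≤ localEnergy v T → ‖w‖ ≤ B := by
      intro w hw
      refine Real.le_sqrt_of_sq_le ?_
      rw [le_div_iff₀ hα]
      linarith
    have hcardE : (Fintype.card E : ℝ) ≤ nearCard d θ := by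
      refine le_trans ?_ (card_nearElements_le hθ hh hball T)
      rw [← Set.toFinset_card]
      exact_mod_cast Finset.card_le_card fun A hA =>
        Finset.mem_filter.2 ⟨Finset.mem_univ A, hnear A (Set.mem_toFinset.1 hA)⟩
    have h1 := norm_sub_le_of_preconnected hconn (fun A : E => slope (v A)) hB0
      (fun A A' hAA' => hle _ (localConst_mul_sub_le hd hθ hh hball hρ v (hnear A A.2)
        (hnear A' A'.2) hAA')) ⟨T, hTE⟩ ⟨S, hSE⟩
    have h2 : ‖slope (v S)‖ ≤ B := hle _ (huncut S hS (hnear S hSE))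
    have h3 : ‖slope (v T)‖ ≤ (1 + nearCard d θ) * B := by
      have h4 := norm_le_norm_add_norm_sub' (slope (v T)) (slope (v S))
      have h5 : (Fintype.card E : ℝ) * B ≤ nearCard d θ * B := by gcongr
      simp only at h1
      linarith
    calc localConst d θ * M.size ^ d * ‖slope (v T)‖ ^ 2
        ≤ localConst d θ * M.size ^ d * ((1 + nearCard d θ) * B) ^ 2 := by gcongr
      _ = (1 + nearCard d θ) ^ 2 * localEnergy v T := by
          have hc := (localConst_pos (d := d) hθ).ne'
          rw [mul_pow, hBdef, Real.sq_sqrt (by positivity)]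
          field_simp
  · refine (huncut T hT hself).trans (le_mul_of_one_le_left hQ ?_)
    exact one_le_pow₀ (by linarith)

/-- The ghost penalty extends the control of the gradient from `Ω^h` to the full active mesh. -/
lemma sum_gradient_le (hρ : IsPiecewiseLinear M ρh)
    (hcluster : ∀ T : activeBulk M ρh, (T : Finset (Pt d)) ∈ activeSurface M ρh →
      ∃ E : Set (activeBulk M ρh), T ∈ E ∧ (∃ S ∈ E, (S : Finset (Pt d)) ∉ activeSurface M ρh) ∧
        (∀ S ∈ E, NearElements T S) ∧ ((facetGraph M ρh).induce E).Preconnected)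
    {μ τ : ℝ} (hμ : 0 < μ) (hτ : 0 < τ) (v : BulkSpace M ρh) :
    M.size ^ d * ∑ T, ‖slope (v T)‖ ^ 2 ≤ gradientConst d θ τ *
      (gradForm M ρh v v + jumpForm M ρh v v + ghostForm M ρh μ τ v v) := by
  classical
  have hN := nearCard_pos (d := d) hθ
  have hc := localConst_pos (d := d) hθ
  have hJ0 : ∀ p : ActivePair M ρh, 0 ≤ M.size⁻¹ * jumpSq v p := fun p =>
    mul_nonneg (inv_pos.2 hh).le (jumpSq_nonneg v p)
  have hK0 : ∀ p : ActivePair M ρh, 0 ≤ M.size * gradJumpSq v p := fun p =>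
    mul_nonneg hh.le (gradJumpSq_nonneg v p)
  have hsum : ∑ T, localEnergy v T ≤ nearCard d θ * (gradForm M ρh v v + jumpForm M ρh v v +
      ∑ p ∈ ghostFaces M ρh, M.size * gradJumpSq v p) := by
    unfold localEnergy
    rw [Finset.sum_add_distrib, Finset.sum_add_distrib, gradForm_self, jumpForm_self, mul_add,
      mul_add]
    refine add_le_add (add_le_add ?_ ?_) ?_
    · exact sum_sum_filter_le _ _ (elementEnergy_nonneg v) fun S _ => by
        convert card_nearElements_le' hθ hh hball S
    · exact sum_sum_filter_le _ (fun T (p : ActivePair M ρh) => NearElements T p.1) hJ0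
        fun p _ => by convert card_nearElements_le' hθ hh hball p.1
    · exact sum_sum_filter_le _ (fun T (p : ActivePair M ρh) => NearElements T p.1) hK0
        fun p _ => by convert card_nearElements_le' hθ hh hball p.1
  have hghost : ∑ p ∈ ghostFaces M ρh, M.size * gradJumpSq v p ≤
      τ⁻¹ * ghostForm M ρh μ τ v v := by
    rw [ghostForm_self, mul_add, ← mul_assoc τ⁻¹ τ, inv_mul_cancel₀ hτ.ne', one_mul]
    refine le_add_of_nonneg_left ?_
    have : 0 ≤ ∑ p ∈ ghostFaces M ρh, jumpSq v p := Finset.sum_nonneg fun p _ => jumpSq_nonneg v p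
    positivity
  have hG : 0 ≤ gradForm M ρh v v := by
    rw [gradForm_self]
    exact Finset.sum_nonneg fun T _ => elementEnergy_nonneg v T
  have hJ : 0 ≤ jumpForm M ρh v v := by
    rw [jumpForm_self]
    exact Finset.sum_nonneg fun p _ => hJ0 p
  have hτj : 0 ≤ τ⁻¹ * ghostForm M ρh μ τ v v :=
    (Finset.sum_nonneg fun p _ => hK0 p).trans hghost
  have hj : 0 ≤ ghostForm M ρh μ τ v v := nonneg_of_mul_nonneg_right hτj (inv_pos.2 hτ)
  have hτ' : 0 < τ⁻¹ := inv_pos.2 hτ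
  have hrest : gradForm M ρh v v + jumpForm M ρh v v +
      ∑ p ∈ ghostFaces M ρh, M.size * gradJumpSq v p ≤
      (1 + τ⁻¹) * (gradForm M ρh v v + jumpForm M ρh v v + ghostForm M ρh μ τ v v) := by
    nlinarith [mul_nonneg hτ'.le hG, mul_nonneg hτ'.le hJ]
  have hpoint : localConst d θ * (M.size ^ d * ∑ T, ‖slope (v T)‖ ^ 2) ≤
      (1 + nearCard d θ) ^ 2 * ∑ T, localEnergy v T := by
    rw [← mul_assoc, Finset.mul_sum, Finset.mul_sum]
    exact Finset.sum_le_sum fun T _ =>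
      gradient_le_localEnergy hd hθ hh hball hρ hcluster v T
  calc M.size ^ d * ∑ T, ‖slope (v T)‖ ^ 2
      = (localConst d θ)⁻¹ * (localConst d θ * (M.size ^ d * ∑ T, ‖slope (v T)‖ ^ 2)) := by
        field_simp
    _ ≤ (localConst d θ)⁻¹ * ((1 + nearCard d θ) ^ 2 * (nearCard d θ * ((1 + τ⁻¹) *
        (gradForm M ρh v v + jumpForm M ρh v v + ghostForm M ρh μ τ v v)))) := by
        refine mul_le_mul_of_nonneg_left (hpoint.trans ?_) (inv_pos.2 hc).le
        refine mul_le_mul_of_nonneg_left (hsum.trans ?_) (sq_nonneg _)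
        exact mul_le_mul_of_nonneg_left hrest hN.le
    _ = _ := by unfold gradientConst; ring

lemma sum_bulkFaces_gradient_le (v : BulkSpace M ρh) :
    ∑ p ∈ bulkFaces M ρh, (‖slope (v p.1)‖ ^ 2 + ‖slope (v p.2)‖ ^ 2) / 2 ≤
      nearCard d θ * ∑ T, ‖slope (v T)‖ ^ 2 := by
  classical
  have hsub : bulkFaces M ρh ⊆
      Finset.univ.filter fun p : ActivePair M ρh => NearElements p.1 p.2 := by
    intro p hp
    obtain ⟨x, hx⟩ := face_nonempty hd hp
    refine Finset.mem_filter.2 ⟨Finset.mem_univ p, x, hx.1, x, hx.2, ?_⟩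
    rw [dist_self]
    positivity
  have h1 : ∑ p ∈ bulkFaces M ρh, ‖slope (v p.1)‖ ^ 2 ≤
      nearCard d θ * ∑ T, ‖slope (v T)‖ ^ 2 := by
    refine (Finset.sum_le_sum_of_subset_of_nonneg hsub fun _ _ _ => sq_nonneg _).trans ?_
    rw [Finset.sum_filter, Fintype.sum_prod_type_right]
    simp_rw [← Finset.sum_filter]
    exact sum_sum_filter_le Finset.univ (fun B A => NearElements A B) (fun _ => sq_nonneg _)
      fun A _ => by convert card_nearElements_le hθ hh hball A
  have h2 : ∑ p ∈ bulkFaces M ρh, ‖slope (v p.2)‖ ^ 2 ≤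
      nearCard d θ * ∑ T, ‖slope (v T)‖ ^ 2 := by
    refine (Finset.sum_le_sum_of_subset_of_nonneg hsub fun _ _ _ => sq_nonneg _).trans ?_
    rw [Finset.sum_filter, Fintype.sum_prod_type]
    simp_rw [← Finset.sum_filter]
    exact sum_sum_filter_le Finset.univ (fun A B => NearElements A B) (fun _ => sq_nonneg _)
      fun A _ => by convert card_nearElements_le' hθ hh hball A
  rw [← Finset.sum_div, Finset.sum_add_distrib]
  linarith

lemma two_mul_abs_fluxForm_le (v : BulkSpace M ρh) {ε : ℝ} (hε : 0 < ε) :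
    2 * |fluxForm M ρh v v| ≤ ε * discVolume d * nearCard d θ *
      (M.size ^ d * ∑ T, ‖slope (v T)‖ ^ 2) + ε⁻¹ * jumpForm M ρh v v := by
  have hω := discVolume_pos (d := d)
  calc 2 * |fluxForm M ρh v v|
      ≤ ∑ p ∈ bulkFaces M ρh, 2 * |∫ x in face p ∩ discreteBulk M ρh,
          meanFlux v p x * jump v p x ∂μHE[d - 1]| := by
        rw [← Finset.mul_sum]
        gcongr
        exact Finset.abs_sum_le_sum_abs _ _
    _ ≤ ∑ p ∈ bulkFaces M ρh, (ε * discVolume d * M.size ^ d *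
          ((‖slope (v p.1)‖ ^ 2 + ‖slope (v p.2)‖ ^ 2) / 2) +
            ε⁻¹ * (M.size⁻¹ * jumpSq v p)) :=
        Finset.sum_le_sum fun p hp => two_mul_abs_flux_le hd hθ hh hball v hp hε
    _ = ε * discVolume d * M.size ^ d *
          (∑ p ∈ bulkFaces M ρh, (‖slope (v p.1)‖ ^ 2 + ‖slope (v p.2)‖ ^ 2) / 2) +
            ε⁻¹ * jumpForm M ρh v v := by
        rw [Finset.sum_add_distrib, ← Finset.mul_sum, ← Finset.mul_sum, jumpForm_self]
    _ ≤ ε * discVolume d * M.size ^ d * (nearCard d θ * ∑ T, ‖slope (v T)‖ ^ 2) +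
            ε⁻¹ * jumpForm M ρh v v := by
        gcongr
        exact sum_bulkFaces_gradient_le hd hθ hh hball v
    _ = _ := by ring

end Gradient

end CutDG

end


/-! ### Coercivity -/

theorem mainTheorem3 (d : ℕ) (hd : 1 ≤ d) (σ κ μ τ : ℝ) (hσ : 0 < σ) (hκ : 0 < κ)
    (hμ : 0 < μ) (hτ : 0 < τ) :
    ∃ γ₀ : ℝ, 0 < γ₀ ∧ ∃ c : ℝ, 0 < c ∧
      ∀ Ω : Set (CutDG.Pt d), CutDG.IsSmoothDomain Ω →
      ∀ δ₀ : ℝ, CutDG.IsTubularRadius Ω δ₀ → ∀ C : ℝ, 0 < C →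
      ∃ h₀ : ℝ, 0 < h₀ ∧
        ∀ (M : CutDG.Mesh d) (ρh : CutDG.Pt d → ℝ),
          M.IsShapeRegular σ → M.IsQuasiUniform κ → M.size ≤ h₀ →
          CutDG.IsAdmissibleCut Ω δ₀ C M ρh →
          ∀ γ : ℝ, γ₀ ≤ γ → ∀ v : CutDG.BulkSpace M ρh,
            c * CutDG.energyNormSq M ρh μ τ v ≤ CutDG.stabilizedForm M ρh γ μ τ v v := by
  open CutDG in
  set θ := (κ * σ)⁻¹ with hθdef
  have hθ : 0 < θ := by positivity
  have hN := nearCard_pos (d := d) hθ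
  have hω := discVolume_pos (d := d)
  have hK : 0 < gradientConst d θ τ := by
    have := localConst_pos (d := d) hθ
    unfold gradientConst
    positivity
  -- With this `ε` the flux absorbs at most half of the gradient, jump and ghost penalty terms.
  set ε := (2 * discVolume d * nearCard d θ * gradientConst d θ τ)⁻¹ with hεdef
  have hε : 0 < ε := by positivity
  refine ⟨1 + ε⁻¹, by positivity, 1 / 2, by norm_num, fun Ω hΩ δ₀ hδ C hC => ?_⟩
  obtain ⟨r, hr, hflat⟩ := hΩ.exists_flat_radius
  refine ⟨min (1 / (4 * C)) (min (r / 16) (δ₀ / 16)), ?_, ?_⟩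
  · have := hδ.1
    positivity
  intro M ρh hreg hquasi hsize hcut γ hγ v
  have hh : 0 < M.size := by
    obtain ⟨x, hx⟩ := hΩ.isConnected.nonempty
    obtain ⟨T, hT, -⟩ := Set.mem_iUnion₂.1 (hcut.covers (Or.inl hx))
    exact Mesh.size_pos hd hT
  have hball : ∀ T ∈ M.elements, ∃ x, Metric.closedBall x (θ * M.size) ⊆ simplex T := fun T hT =>
    Mesh.exists_closedBall_subset hσ hκ hreg hquasi hT
  have hCh : C * M.size ≤ 1 / 4 := by
    have := hsize.trans (min_le_left _ _)
    rw [le_div_iff₀ (by positivity)] at this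
    linarith
  have hrh : 15 * M.size < r := by
    have := hsize.trans ((min_le_right _ _).trans (min_le_left _ _))
    linarith
  have hδh : 15 * M.size < δ₀ := by
    have := hsize.trans ((min_le_right _ _).trans (min_le_right _ _))
    linarith
  have hgrad := sum_gradient_le hd hθ hh hball hcut.piecewiseLinear
    (fun T hT => exists_cluster hd hδ hflat hcut hh hCh hrh hδh T hT) hμ hτ v
  have hflux := two_mul_abs_fluxForm_le hd hθ hh hball v hε
  have hG : 0 ≤ gradForm M ρh v v := by
    rw [gradForm_self]
    exact Finset.sum_nonneg fun T _ => elementEnergy_nonneg v T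
  have hJ : 0 ≤ jumpForm M ρh v v := by
    rw [jumpForm_self]
    exact Finset.sum_nonneg fun p _ => mul_nonneg (inv_pos.2 hh).le (jumpSq_nonneg v p)
  have hj : 0 ≤ ghostForm M ρh μ τ v v := by
    rw [ghostForm_self]
    have h1 : 0 ≤ ∑ p ∈ ghostFaces M ρh, jumpSq v p :=
      Finset.sum_nonneg fun p _ => jumpSq_nonneg v p
    have h2 : 0 ≤ ∑ p ∈ ghostFaces M ρh, M.size * gradJumpSq v p :=
      Finset.sum_nonneg fun p _ => mul_nonneg hh.le (gradJumpSq_nonneg v p)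
    positivity
  have hm := massForm_self_nonneg v
  have habsorb : ε * discVolume d * nearCard d θ * (M.size ^ d * ∑ T, ‖slope (v T)‖ ^ 2) ≤
      1 / 2 * (gradForm M ρh v v + jumpForm M ρh v v + ghostForm M ρh μ τ v v) := by
    calc ε * discVolume d * nearCard d θ * (M.size ^ d * ∑ T, ‖slope (v T)‖ ^ 2)
        ≤ ε * discVolume d * nearCard d θ * (gradientConst d θ τ *
          (gradForm M ρh v v + jumpForm M ρh v v + ghostForm M ρh μ τ v v)) := by gcongr
      _ = _ := by rw [hεdef]; field_simp
  have hflux' : 2 * fluxForm M ρh v v ≤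
      1 / 2 * (gradForm M ρh v v + jumpForm M ρh v v + ghostForm M ρh μ τ v v) +
        ε⁻¹ * jumpForm M ρh v v := by
    have := le_abs_self (fluxForm M ρh v v)
    linarith
  have hγJ : (1 + ε⁻¹) * jumpForm M ρh v v ≤ γ * jumpForm M ρh v v := by gcongr
  unfold energyNormSq stabilizedForm bulkForm
  linarith
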